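/- Let $U:\mathbb{R}^d\to\mathbb{R}$ be three times continuously differentiable with $L:=\sup_x\|D^2U(x)\|<\infty$ and $L_H:=\sup_x\|D^3U(x)\|<\infty$, where $\|\cdot\|$ is the operator norm of a multilinear form with respect to the Euclidean norm. Let $T>0$ and $h>0$ satisfy $N:=T/h\in\mathbb{N}$ and $$L\,(T^2+Th)\ \le\ \tfrac16 .$$ For $x,v\in\mathbb{R}^d$ let $\tilde q_T(x,v)$ be the position after $N$ steps of the velocity Verlet integrator $$q_{k+1}=q_k+h\,v_k-\tfrac{h^2}{2}\nabla U(q_k),\qquad v_{k+1}=v_k-\tfrac h2\big(\nabla U(q_k)+\nabla U(q_{k+1})\big),\qquad (q_0,v_0)=(x,v),$$ and let $\tilde\pi(x,\cdot)$ be the law of $\tilde q_T(x,\xi)$ with $\xi\sim\mathcal N(0,I_d)$; this is the transition kernel of unadjusted Hamiltonian Monte Carlo (uHMC). For probability measures $\nu,\eta$ on $\mathbb{R}^d$ let $\mathrm{TV}(\nu,\eta)=\sup_A|\nu(A)-\eta(A)|$ (supremum over Borel sets $A$) and let $W^1(\nu,\eta)\in[0,\infty]$ be the infimum of $E|X-Y|$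 over all couplings $(X,Y)$ of $\nu$ and $\eta$. Suppose that $\tilde\mu$ is an invariant probability measure of $\tilde\pi$ and that there are constants $M_1,c\in(0,\infty)$ such that for every integer $m\ge1$ and every probability measure $\nu$ on $\mathbb{R}^d$, $$W^1(\nu\tilde\pi^m,\tilde\mu)\ \le\ M_1\,e^{-cm}\,W^1(\nu,\tilde\mu).$$ Then for every integer $m\ge0$ and every probability measure $\nu$ on $\mathbb{R}^d$, $$\mathrm{TV}(\tilde\mu,\nu\tilde\pi^{m+1})\ \le\ \tfrac32\,\big(T^{-2}+27\,d\,L_H^2\,T^4\big)^{1/2}\,M_1\,W^1(\tilde\mu,\nu)\,e^{-cm}.$$ -/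

import Mathlib

open MeasureTheory ProbabilityTheory
open scoped ENNReal

/-- The total variation distance `sup {|ν(A) - η(A)| : A measurable}` of two finite measures,
as an element of `[0, ∞]`. -/
noncomputable def tvDist {E : Type*} [MeasurableSpace E] (ν η : Measure E) : ℝ≥0∞ :=
  ⨆ (A : Set E) (_ : MeasurableSet A), ENNReal.ofReal |ν.real A - η.real A|

/-- `γ` is a coupling of `ν` and `η`: its first marginal is `ν` and its second marginal is `η`. -/
def IsCoupling {E : Type*} [MeasurableSpace E] (γ : Measure (E × E)) (ν η : Measure E) : Prop :=
  γ.map Prod.fst = ν ∧ γ.map Prod.snd = η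

/-- The `L¹`-Wasserstein distance of `ν` and `η`, with values in `[0, ∞]`: the infimum of
`E[d(X, Y)]` over all couplings of `ν` and `η`. -/
noncomputable def wassersteinOne {E : Type*} [MeasurableSpace E] [PseudoEMetricSpace E]
    (ν η : Measure E) : ℝ≥0∞ :=
  ⨅ (γ : Measure (E × E)) (_ : IsCoupling γ ν η), ∫⁻ p, edist p.1 p.2 ∂γ

/-- One step of the velocity Verlet integrator with potential `U` and step size `h`, acting on
(position, velocity):
`q' = q + h v - (h²/2) ∇U(q)` and `v' = v - (h/2) (∇U(q) + ∇U(q'))`. -/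
noncomputable def verletStep {d : ℕ} (U : EuclideanSpace ℝ (Fin d) → ℝ) (h : ℝ)
    (z : EuclideanSpace ℝ (Fin d) × EuclideanSpace ℝ (Fin d)) :
    EuclideanSpace ℝ (Fin d) × EuclideanSpace ℝ (Fin d) :=
  let q' := z.1 + h • z.2 - (h ^ 2 / 2) • gradient U z.1
  (q', z.2 - (h / 2) • (gradient U z.1 + gradient U q'))

/-- The position after `N` velocity Verlet steps of size `h`, that is at time `T = N h`,
started from the position and velocity `z = (x, v)`. -/
noncomputable def verletPosition {d : ℕ} (U : EuclideanSpace ℝ (Fin d) → ℝ) (h : ℝ) (N : ℕ)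
    (z : EuclideanSpace ℝ (Fin d) × EuclideanSpace ℝ (Fin d)) : EuclideanSpace ℝ (Fin d) :=
  ((verletStep U h)^[N] z).1

/-- The transition kernel of unadjusted Hamiltonian Monte Carlo with potential `U`, step size `h`
and duration `T = N h`: from `x`, draw a velocity `ξ` from the standard Gaussian distribution and
move to the position at time `T` of the Verlet solution started at `(x, ξ)`.
(`Kernel.map` has the junk value `0` for a non-measurable map; see `uhmcKernel_apply`.) -/
noncomputable def uhmcKernel {d : ℕ} (U : EuclideanSpace ℝ (Fin d) → ℝ) (h : ℝ) (N : ℕ) :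
    Kernel (EuclideanSpace ℝ (Fin d)) (EuclideanSpace ℝ (Fin d)) :=
  (Kernel.id ×ₖ Kernel.const _ (stdGaussian (EuclideanSpace ℝ (Fin d)))).map
    (verletPosition U h N)

/-- For continuously differentiable `U`, the Verlet position is measurable in `(x, v)`. -/
theorem measurable_verletPosition {d : ℕ} {U : EuclideanSpace ℝ (Fin d) → ℝ}
    (hU : ContDiff ℝ 1 U) (h : ℝ) (N : ℕ) : Measurable (verletPosition U h N) := by
  have hg : Continuous (gradient U) := by
    unfold gradient
    exact (LinearIsometryEquiv.continuous _).comp (hU.continuous_fderiv one_ne_zero)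
  have hs : Continuous (verletStep U h) := by
    unfold verletStep
    fun_prop
  exact (continuous_fst.comp (hs.iterate N)).measurable

/-- For continuously differentiable `U`, the measure `uhmcKernel U h N x` is the law of the Verlet
position at time `N h` started at `(x, ξ)`, where `ξ` is standard Gaussian. -/
theorem uhmcKernel_apply {d : ℕ} {U : EuclideanSpace ℝ (Fin d) → ℝ}
    (hU : ContDiff ℝ 1 U) (h : ℝ) (N : ℕ) (x : EuclideanSpace ℝ (Fin d)) :
    uhmcKernel U h N x =
      (stdGaussian (EuclideanSpace ℝ (Fin d))).map (fun v => verletPosition U h N (x, v)) := by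
  have hm := measurable_verletPosition hU h N
  rw [uhmcKernel, Kernel.map_apply _ hm, Kernel.prod_apply, Kernel.id_apply, Kernel.const_apply,
    Measure.dirac_prod, Measure.map_map hm (by fun_prop)]
  rfl

/-! The core is a one-step smoothing estimate: the kernel is Lipschitz from points to total
variation. Given `x` and `y`, the short-time condition makes `v ↦ q_T(x, v)` a bijection close to `T
• id`, so some map `Φ` satisfies `q_T(y, Φ v) = q_T(x, v)`. The two transition laws are thus images
under one map of the Gaussian moved by `Φ` and of the Gaussian itself (`exists_velocity_transport`),
and it suffices to compare the latter two.

That comparison goes through the Hellinger affinity (`abs_stdGaussian_sub_preimage_le`). With `g = Φ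
- id`, half the logarithm of the density ratio is at least `(tr Dg - ⟨v, g⟩ - K) / 2`, where `K = a²
/ 2 + d δ²`, `‖g‖ ≤ a` and `‖Dg‖ ≤ δ`. By `exp t ≥ 1 + t`, and since Gaussian integration by parts
cancels the mean of `tr Dg - ⟨v, g⟩`, the affinity is at least `1 - K / 2`; hence total variation is
at most `√K`. Here `a` is of order `|x - y| / T` and `δ` of order `L_H T² |x - y|`.

Integrating over couplings gives `TV ≤ C W¹` after one step, and the assumed contraction handles the
preceding `m` steps. For `m = 0` no contraction is assumed, so the factor `M₁` must be shown not to
be too small: one Verlet step of the chain cannot shrink a translation of part of `μ` by more than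
`10/11`, which forces `M₁ ≥ 10/11` (`le_of_forall_wassersteinOne_bind_uhmcKernel_le`), and the
constant `3/2` absorbs this loss. -/

/-! ### Determinants of perturbations of the identity. -/

section Determinant

theorem det_mul_clm {E : Type*} [NormedAddCommGroup E] [NormedSpace ℝ E] (A B : E →L[ℝ] E) : (A * B).det = A.det * B.det := by
  simp only [ContinuousLinearMap.det, ContinuousLinearMap.toLinearMap_mul, map_mul]

variable {E : Type*} [NormedAddCommGroup E] [InnerProductSpace ℝ E] [FiniteDimensional ℝ E]

theorem abs_trace_le_finrank_mul_opNorm (B : E →L[ℝ] E) :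
    |LinearMap.trace ℝ E (B : E →ₗ[ℝ] E)| ≤ Module.finrank ℝ E * ‖B‖ := by
  let b := stdOrthonormalBasis ℝ E
  rw [LinearMap.trace_eq_sum_inner _ b]
  refine (Finset.abs_sum_le_sum_abs _ _).trans ?_
  refine (Finset.sum_le_card_nsmul _ _ ‖B‖ fun i _ => ?_).trans (by simp)
  refine (abs_real_inner_le_norm _ _).trans ?_
  have := B.le_opNorm (b i)
  simpa using this

theorem hasDerivAt_det_one_add_smul_zero (A : E →L[ℝ] E) :
    HasDerivAt (fun r : ℝ => (1 + r • A).det) (LinearMap.trace ℝ E (A : E →ₗ[ℝ] E)) 0 := by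
  let b := (stdOrthonormalBasis ℝ E).toBasis
  let M := LinearMap.toMatrix b b (A : E →ₗ[ℝ] E)
  have h1 : ∀ r : ℝ, (1 + r • A).det = (1 + r • M).det := fun r => by
    rw [ContinuousLinearMap.det, ← LinearMap.det_toMatrix b]
    congr 1
    simp [M, LinearMap.toMatrix_one]
  rw [funext fun r => (h1 r).trans (Matrix.det_one_add_smul r M)]
  rw [LinearMap.trace_eq_matrix_trace ℝ b]
  set p := (1 + (Polynomial.X : Polynomial ℝ) • M.map Polynomial.C).det.divX.divX
  have h2 : HasDerivAt (fun r : ℝ => 1 + M.trace * r + p.eval r * r ^ 2)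
      (0 + M.trace * 1 + (p.derivative.eval 0 * (0 : ℝ) ^ 2 + p.eval 0 * (2 * (0:ℝ) ^ (2 - 1) * 1))) 0 :=
    (((hasDerivAt_const _ _).add ((hasDerivAt_id (0 : ℝ)).const_mul _))).add
      ((p.hasDerivAt 0).mul ((hasDerivAt_id (0 : ℝ)).pow 2))
  simpa using h2

/-- Along `s ↦ 1 + s A` the logarithmic derivative of the determinant is `tr B` with `B = (1 + s
A)⁻¹ A`. Since `A - B = s A B` and `‖B‖ ≤ 2 δ`, it differs from `tr A` by at most `2 s n δ²`;
integrating over `[0, 1]` gives the error `n δ²`. -/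
theorem exp_trace_sub_le_abs_det (A : E →L[ℝ] E) {δ : ℝ} (hA : ‖A‖ ≤ δ) (hδ : δ ≤ 1 / 5) :
    Real.exp (LinearMap.trace ℝ E (A : E →ₗ[ℝ] E) - Module.finrank ℝ E * δ ^ 2) ≤
      |(1 + A).det| := by
  have hδ0 : 0 ≤ δ := (norm_nonneg _).trans hA
  set n : ℝ := (Module.finrank ℝ E : ℝ) with hn
  have hn0 : 0 ≤ n := by positivity
  set t : (E →L[ℝ] E) → ℝ := fun B => LinearMap.trace ℝ E (B : E →ₗ[ℝ] E) with ht
  have key : ∀ s ∈ Set.Icc (0 : ℝ) 1, (1 + s • A).det ≠ 0 ∧ ∃ d' : ℝ,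
      HasDerivAt (fun s : ℝ => Real.log (1 + s • A).det) d' s ∧ t A - 2 * s * (n * δ ^ 2) ≤ d' := by
    intro s hs
    have hsA : ‖s • A‖ ≤ δ := by
      rw [norm_smul, Real.norm_of_nonneg hs.1]
      nlinarith [hs.1, hs.2, norm_nonneg A]
    have hu : ‖-(s • A)‖ < 1 := by rw [norm_neg]; linarith
    let u := Units.oneSub (-(s • A)) hu
    have hu1 : (u : E →L[ℝ] E) = 1 + s • A := by simp [u]
    set B : E →L[ℝ] E := (↑u⁻¹ : E →L[ℝ] E) * A with hB
    have hAB : (1 + s • A) * B = A := by rw [hB, ← mul_assoc, ← hu1]; simp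
    have hdet : (1 + s • A).det ≠ 0 := by
      have : (1 + s • A).det * (↑u⁻¹ : E →L[ℝ] E).det = 1 := by
        rw [← det_mul_clm, ← hu1]; simp [ContinuousLinearMap.det]
      exact left_ne_zero_of_mul_eq_one this
    have hAB' : A - B = s • (A * B) := by
      have := hAB
      rw [add_mul, one_mul, smul_mul_assoc] at this
      rw [sub_eq_iff_eq_add, add_comm]; exact this.symm
    have hmul : ‖A * B‖ ≤ δ * ‖B‖ := (norm_mul_le _ _).trans (by gcongr)
    have hBn : ‖B‖ ≤ 2 * δ := by
      have h1 : ‖B‖ ≤ ‖A‖ + ‖A - B‖ := by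
        calc ‖B‖ = ‖A - (A - B)‖ := by congr 1; abel
          _ ≤ _ := norm_sub_le _ _
      rw [hAB', norm_smul, Real.norm_of_nonneg hs.1] at h1
      nlinarith [hs.1, hs.2, norm_nonneg (A * B), norm_nonneg B]
    refine ⟨hdet, t B, ?_, ?_⟩
    · have h1 := hasDerivAt_det_one_add_smul_zero B
      have h2 : HasDerivAt (fun r : ℝ => (1 + (r - s) • B).det) (t B) s := by
        have : HasDerivAt (fun r : ℝ => r - s) 1 s := (hasDerivAt_id s).sub_const s
        have h3 := HasDerivAt.comp (h₂ := fun r : ℝ => (1 + r • B).det) s (by simpa using h1) this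
        simpa [Function.comp_def] using h3
      have h4 : HasDerivAt (fun r : ℝ => (1 + r • A).det) ((1 + s • A).det * t B) s := by
        -- The factorisation `1 + r A = (1 + s A)(1 + (r - s) B)` reduces the derivative at `s` to
        -- the derivative at the identity.
        have h5 : (fun r : ℝ => (1 + r • A).det) =
            fun r : ℝ => (1 + s • A).det * (1 + (r - s) • B).det := by
          funext r
          rw [← det_mul_clm, mul_add, mul_smul_comm, hAB, mul_one, add_assoc, ← add_smul]
          simp
        rw [h5]
        exact h2.const_mul _
      have h6 := h4.log hdet
      rwa [mul_div_cancel_left₀ _ hdet] at h6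
    · have h1 : t A - t B = t (A - B) := by simp [ht]
      have h2 := (le_abs_self _).trans (abs_trace_le_finrank_mul_opNorm (A - B))
      rw [hAB', norm_smul, Real.norm_of_nonneg hs.1] at h2
      have h3 : n * (s * ‖A * B‖) ≤ n * (s * (2 * δ ^ 2)) := by
        have := hs.1
        gcongr
        nlinarith
      have h4 : t (A - B) ≤ n * (s * ‖A * B‖) := by rw [hAB']; exact h2
      linarith
  have hmono : MonotoneOn
      (fun s : ℝ => Real.log (1 + s • A).det - s * t A + s ^ 2 * (n * δ ^ 2)) (Set.Icc 0 1) := by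
    have hd : ∀ s ∈ Set.Icc (0 : ℝ) 1, ∃ d' : ℝ, HasDerivAt
        (fun s : ℝ => Real.log (1 + s • A).det - s * t A + s ^ 2 * (n * δ ^ 2)) d' s ∧ 0 ≤ d' := by
      intro s hs
      obtain ⟨-, d', h1, h2⟩ := key s hs
      refine ⟨_, (h1.sub ((hasDerivAt_id s).mul_const (t A))).add
        (((hasDerivAt_id s).pow 2).mul_const _), ?_⟩
      simp
      linarith
    refine monotoneOn_of_deriv_nonneg (convex_Icc 0 1)
      (fun s hs => (hd s hs).choose_spec.1.continuousAt.continuousWithinAt)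
      (fun s hs => ?_) (fun s hs => ?_)
    · exact (hd s (interior_subset hs)).choose_spec.1.differentiableAt.differentiableWithinAt
    · obtain ⟨d', h1, h2⟩ := hd s (interior_subset hs)
      rwa [h1.deriv]
  have h01 := hmono (by simp : (0 : ℝ) ∈ Set.Icc (0 : ℝ) 1) (by simp : (1 : ℝ) ∈ Set.Icc (0 : ℝ) 1)
    zero_le_one
  have hone : (1 : E →L[ℝ] E).det = 1 := by simp [ContinuousLinearMap.det]
  simp only [zero_smul, add_zero, hone, Real.log_one, one_smul, zero_mul, one_mul] at h01
  have hne : (1 + A).det ≠ 0 := by simpa using (key 1 (by simp)).1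
  -- `Real.log` is the logarithm of the absolute value, so the sign of the determinant never has to
  -- be known.
  rw [← Real.exp_log (abs_pos.2 hne), Real.log_abs]
  apply Real.exp_le_exp.2
  change t A - _ ≤ _
  linarith

end Determinant

/-! ### From Hellinger affinity to total variation. -/

/-- Here `X` is the square root of a density and `∫ X` the affinity. A weighted AM-GM inequality for
`|X² - 1| = |X - 1| (X + 1)`, with `∫ (X - 1)² ≤ K` and `∫ (X + 1)² ≤ 4`, gives `∫ |X² - 1| ≤ 2 √K`.
-/
theorem abs_setIntegral_sq_sub_measureReal_le {Ω : Type*} [MeasurableSpace Ω] (γ : Measure Ω)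
    [IsProbabilityMeasure γ] {X : Ω → ℝ} (hX2 : Integrable (fun ω => X ω ^ 2) γ)
    (hX1 : Integrable X γ) (h0 : ∀ ω, 0 ≤ X ω)
    (h1 : ∫ ω, X ω ^ 2 ∂γ = 1) {K : ℝ} (hK : 0 < K) (hE : 1 - K / 2 ≤ ∫ ω, X ω ∂γ)
    {C : Set Ω} (hC : MeasurableSet C) :
    |∫ ω in C, X ω ^ 2 ∂γ - γ.real C| ≤ √K := by
  set m := ∫ ω, X ω ∂γ
  have hY : Integrable (fun ω => X ω ^ 2 - 1) γ := hX2.sub (integrable_const 1)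
  have hsub : ∀ D : Set Ω, ∫ ω in D, (X ω ^ 2 - 1) ∂γ = ∫ ω in D, X ω ^ 2 ∂γ - γ.real D := by
    intro D
    rw [integral_sub hX2.integrableOn (integrable_const 1)]
    simp
  have hD : Integrable (fun ω => X ω ^ 2 - 2 * X ω) γ := hX2.sub (hX1.const_mul 2)
  have hD' : Integrable (fun ω => X ω ^ 2 + 2 * X ω) γ := hX2.add (hX1.const_mul 2)
  have hsq : ∫ ω, (X ω - 1) ^ 2 ∂γ = 2 - 2 * m := by
    have : ∀ ω, (X ω - 1) ^ 2 = X ω ^ 2 - 2 * X ω + 1 := fun ω => by ring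
    simp_rw [this]
    rw [integral_add hD (integrable_const 1),
      integral_sub hX2 (hX1.const_mul 2), integral_const_mul, h1]
    simp
    ring
  have hsq' : ∫ ω, (X ω + 1) ^ 2 ∂γ = 2 + 2 * m := by
    have : ∀ ω, (X ω + 1) ^ 2 = X ω ^ 2 + 2 * X ω + 1 := fun ω => by ring
    simp_rw [this]
    rw [integral_add hD' (integrable_const 1),
      integral_add hX2 (hX1.const_mul 2), integral_const_mul, h1]
    simp
    ring
  have hi : Integrable (fun ω => (X ω - 1) ^ 2) γ := by
    have : (fun ω => (X ω - 1) ^ 2) = fun ω => X ω ^ 2 - 2 * X ω + 1 := by ext; ring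
    rw [this]
    exact hD.add (integrable_const 1)
  have hi' : Integrable (fun ω => (X ω + 1) ^ 2) γ := by
    have : (fun ω => (X ω + 1) ^ 2) = fun ω => X ω ^ 2 + 2 * X ω + 1 := by ext; ring
    rw [this]
    exact hD'.add (integrable_const 1)
  have hm1 : m ≤ 1 := by
    have : 0 ≤ ∫ ω, (X ω - 1) ^ 2 ∂γ := integral_nonneg fun ω => sq_nonneg _
    linarith
  have hr : 0 < √K := Real.sqrt_pos.2 hK
  have hrr : √K * √K = K := Real.mul_self_sqrt hK.le
  have habs : ∫ ω, |X ω ^ 2 - 1| ∂γ ≤ 2 * √K := by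
    calc ∫ ω, |X ω ^ 2 - 1| ∂γ
        ≤ ∫ ω, ((√K)⁻¹ * (X ω - 1) ^ 2 + √K / 4 * (X ω + 1) ^ 2) ∂γ := by
          refine integral_mono hY.abs ((hi.const_mul _).add (hi'.const_mul _)) fun ω => ?_
          have hfac : X ω ^ 2 - 1 = (X ω - 1) * (X ω + 1) := by ring
          have hab : |X ω ^ 2 - 1| = |X ω - 1| * (X ω + 1) := by
            rw [hfac, abs_mul, abs_of_nonneg (by linarith [h0 ω] : 0 ≤ X ω + 1)]
          have h2 : (√K)⁻¹ * (X ω - 1) ^ 2 + √K / 4 * (X ω + 1) ^ 2 - |X ω - 1| * (X ω + 1) =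
              (√K)⁻¹ * (|X ω - 1| - √K / 2 * (X ω + 1)) ^ 2 := by
            rw [← sq_abs (X ω - 1)]
            field_simp
            ring
          have h3 : 0 ≤ (√K)⁻¹ * (|X ω - 1| - √K / 2 * (X ω + 1)) ^ 2 := by positivity
          simp only [hab]
          linarith
      _ = (√K)⁻¹ * (2 - 2 * m) + √K / 4 * (2 + 2 * m) := by
          rw [integral_add (hi.const_mul _) (hi'.const_mul _), integral_const_mul,
            integral_const_mul, hsq, hsq']
      _ ≤ (√K)⁻¹ * K + √K / 4 * 4 := by gcongr <;> linarith
      _ = 2 * √K := by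
          nth_rewrite 2 [← hrr]
          field_simp
          ring
  -- `X² - 1` has mean zero, so no set carries more than half of its `L¹` norm.
  have hcompl : ∫ ω in C, (X ω ^ 2 - 1) ∂γ = -∫ ω in Cᶜ, (X ω ^ 2 - 1) ∂γ := by
    have h2 := integral_add_compl hC hY
    have h3 : ∫ ω, (X ω ^ 2 - 1) ∂γ = 0 := by
      rw [integral_sub hX2 (integrable_const 1), h1]; simp
    linarith
  have hsum := integral_add_compl hC hY.abs
  have hA := abs_integral_le_integral_abs (μ := γ.restrict C) (f := fun ω => X ω ^ 2 - 1)
  have hB := abs_integral_le_integral_abs (μ := γ.restrict Cᶜ) (f := fun ω => X ω ^ 2 - 1)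
  rw [← abs_neg, ← hcompl] at hB
  rw [← hsub]
  linarith

/-! ### Gaussian integration by parts and near-identity changes of variables. -/

section Gaussian

/-- The density of the standard Gaussian measure with respect to the volume. -/
noncomputable def stdGaussianPDF {E : Type*} [NormedAddCommGroup E] [InnerProductSpace ℝ E] (v : E) : ℝ :=
  ((2 * Real.pi) ^ ((Module.finrank ℝ E : ℝ) / 2))⁻¹ * Real.exp (-(1 / 2) * ‖v‖ ^ 2)

theorem stdGaussianPDF_pos {E : Type*} [NormedAddCommGroup E] [InnerProductSpace ℝ E] (v : E) : 0 < stdGaussianPDF v := by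
  unfold stdGaussianPDF; positivity

theorem continuous_stdGaussianPDF {E : Type*} [NormedAddCommGroup E] [InnerProductSpace ℝ E] : Continuous (stdGaussianPDF : E → ℝ) := by
  unfold stdGaussianPDF; fun_prop

theorem hasFDerivAt_stdGaussianPDF {E : Type*} [NormedAddCommGroup E] [InnerProductSpace ℝ E] (v : E) :
    HasFDerivAt (stdGaussianPDF : E → ℝ) (-(stdGaussianPDF v) • innerSL ℝ v) v := by
  have h := ((((hasStrictFDerivAt_norm_sq v).hasFDerivAt.const_mul (-(1 / 2) : ℝ)).exp).const_mul
    ((2 * Real.pi) ^ ((Module.finrank ℝ E : ℝ) / 2))⁻¹)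
  refine HasFDerivAt.congr_fderiv (f := stdGaussianPDF) h ?_
  ext w
  simp [stdGaussianPDF]
  ring

variable {E : Type*} [NormedAddCommGroup E] [InnerProductSpace ℝ E] [FiniteDimensional ℝ E]
  [MeasurableSpace E] [BorelSpace E]

theorem integrable_stdGaussianPDF : Integrable (stdGaussianPDF : E → ℝ) := by
  have h := (GaussianFourier.integrable_cexp_neg_mul_sq_norm_add (V := E) (b := 1 / 2)
    (by norm_num) 0 0).norm
  refine (h.const_mul ((2 * Real.pi) ^ ((Module.finrank ℝ E : ℝ) / 2))⁻¹).congr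
    (Filter.Eventually.of_forall fun v => ?_)
  simp only [Complex.norm_exp]
  unfold stdGaussianPDF
  congr 2
  simp [← Complex.ofReal_pow]

theorem stdGaussian_eq_withDensity :
    stdGaussian E = volume.withDensity fun v => ENNReal.ofReal (stdGaussianPDF v) := by
  have : IsFiniteMeasure (volume.withDensity fun v : E => ENNReal.ofReal (stdGaussianPDF v)) :=
    isFiniteMeasure_withDensity_ofReal integrable_stdGaussianPDF.2
  apply Measure.ext_of_charFun
  funext t
  rw [charFun_stdGaussian, charFun_apply,
    integral_withDensity_eq_integral_toReal_smul
      (continuous_stdGaussianPDF.measurable.ennreal_ofReal) (by simp)]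
  have h := GaussianFourier.integral_cexp_neg_mul_sq_norm_add (V := E) (b := 1 / 2) (by norm_num)
    Complex.I t
  have h2 : ∀ v : E, (ENNReal.ofReal (stdGaussianPDF v)).toReal • Complex.exp (inner ℝ v t * Complex.I) =
      (((2 * Real.pi) ^ ((Module.finrank ℝ E : ℝ) / 2))⁻¹ : ℝ) *
        Complex.exp (-(1 / 2) * ‖v‖ ^ 2 + Complex.I * inner ℝ t v) := fun v => by
    rw [ENNReal.toReal_ofReal (stdGaussianPDF_pos v).le, Complex.real_smul, stdGaussianPDF,
      Complex.exp_add, real_inner_comm]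
    push_cast
    ring_nf
  simp_rw [h2]
  rw [integral_const_mul, h]
  have h3 : ((Real.pi : ℂ) / (1 / 2)) ^ ((Module.finrank ℝ E : ℂ) / 2) =
      (((2 * Real.pi) ^ ((Module.finrank ℝ E : ℝ) / 2) : ℝ) : ℂ) := by
    rw [Complex.ofReal_cpow (by positivity)]
    push_cast
    congr 1
    ring
  have h4 : ((2 * Real.pi) ^ ((Module.finrank ℝ E : ℝ) / 2) : ℝ) ≠ 0 := by positivity
  rw [h3, ← mul_assoc, ← Complex.ofReal_mul, inv_mul_cancel₀ h4, Complex.ofReal_one, one_mul]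
  congr 1
  rw [Complex.I_sq]
  ring

theorem integral_stdGaussian_eq (f : E → ℝ) :
    ∫ v, f v ∂stdGaussian E = ∫ v, stdGaussianPDF v * f v := by
  rw [stdGaussian_eq_withDensity, integral_withDensity_eq_integral_toReal_smul
      (continuous_stdGaussianPDF.measurable.ennreal_ofReal) (by simp)]
  simp [ENNReal.toReal_ofReal (stdGaussianPDF_pos _).le]

theorem integrable_stdGaussian_iff {f : E → ℝ} :
    Integrable f (stdGaussian E) ↔ Integrable fun v => stdGaussianPDF v * f v := by
  rw [stdGaussian_eq_withDensity, integrable_withDensity_iff_integrable_smul'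
      (continuous_stdGaussianPDF.measurable.ennreal_ofReal) (by simp)]
  simp [ENNReal.toReal_ofReal (stdGaussianPDF_pos _).le]

theorem integrable_norm_stdGaussian : Integrable (fun v : E => ‖v‖) (stdGaussian E) :=
  (IsGaussian.integrable_id (μ := stdGaussian E)).norm

/-- Stein's identity: the Gaussian density has gradient `-v` times itself, so one integrates by
parts in each direction of an orthonormal basis. Boundedness of `g` and its derivative supplies the
integrability. -/
theorem integral_inner_stdGaussian {g : E → E} (hg : Differentiable ℝ g) {a δ : ℝ}
    (ha : ∀ v, ‖g v‖ ≤ a) (hδ : ∀ v, ‖fderiv ℝ g v‖ ≤ δ) :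
    Integrable (fun v => inner ℝ v (g v)) (stdGaussian E) ∧
    Integrable (fun v => LinearMap.trace ℝ E (fderiv ℝ g v : E →ₗ[ℝ] E)) (stdGaussian E) ∧
    ∫ v, inner ℝ v (g v) ∂stdGaussian E =
      ∫ v, LinearMap.trace ℝ E (fderiv ℝ g v : E →ₗ[ℝ] E) ∂stdGaussian E := by
  let b := stdOrthonormalBasis ℝ E
  have hb : ∀ i, ‖b i‖ = 1 := fun i => b.norm_eq_one i
  have ha0 : 0 ≤ a := (norm_nonneg _).trans (ha 0)
  have hδ0 : 0 ≤ δ := (norm_nonneg _).trans (hδ 0)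
  have hsum : ∀ v, inner ℝ v (g v) = ∑ i, inner ℝ v (b i) * inner ℝ (b i) (g v) := fun v =>
    (b.sum_inner_mul_inner v (g v)).symm
  have htr : ∀ v, LinearMap.trace ℝ E (fderiv ℝ g v : E →ₗ[ℝ] E) =
      ∑ i, inner ℝ (b i) (fderiv ℝ g v (b i)) := fun v => by
    rw [LinearMap.trace_eq_sum_inner _ b]; rfl
  have hint1 : ∀ i, Integrable (fun v => inner ℝ v (b i) * inner ℝ (b i) (g v)) (stdGaussian E) := by
    intro i
    refine Integrable.mono' (integrable_norm_stdGaussian.mul_const a) ?_ ?_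
    · have := hg.continuous
      exact Continuous.aestronglyMeasurable (by fun_prop)
    · refine Filter.Eventually.of_forall fun v => ?_
      rw [norm_mul]
      have h1 := norm_inner_le_norm (𝕜 := ℝ) v (b i)
      have h2 := norm_inner_le_norm (𝕜 := ℝ) (b i) (g v)
      rw [hb] at h1 h2
      have := ha v
      gcongr <;> linarith
  have hint2 : ∀ i, Integrable (fun v => inner ℝ (b i) (fderiv ℝ g v (b i))) (stdGaussian E) := by
    intro i
    refine Integrable.mono' (integrable_const δ) ?_ ?_
    · have hm : Measurable fun v => fderiv ℝ g v (b i) := measurable_fderiv_apply_const ℝ g (b i)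
      exact (Measurable.inner measurable_const hm).aestronglyMeasurable
    · refine Filter.Eventually.of_forall fun v => ?_
      have h2 := norm_inner_le_norm (𝕜 := ℝ) (b i) (fderiv ℝ g v (b i))
      have h3 := (fderiv ℝ g v).le_opNorm (b i)
      rw [hb] at h2 h3
      linarith [hδ v]
  have hint3 : ∀ i, Integrable (fun v => inner ℝ (b i) (g v)) (stdGaussian E) := by
    intro i
    refine Integrable.mono' (integrable_const a) ?_ ?_
    · have := hg.continuous
      exact Continuous.aestronglyMeasurable (by fun_prop)
    · refine Filter.Eventually.of_forall fun v => ?_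
      have h2 := norm_inner_le_norm (𝕜 := ℝ) (b i) (g v)
      rw [hb] at h2
      linarith [ha v]
  have hibp : ∀ i, ∫ v, inner ℝ v (b i) * inner ℝ (b i) (g v) ∂stdGaussian E =
      ∫ v, inner ℝ (b i) (fderiv ℝ g v (b i)) ∂stdGaussian E := by
    intro i
    have h1 := integrable_stdGaussian_iff.1 (hint1 i)
    have h2 := integrable_stdGaussian_iff.1 (hint2 i)
    have h3 := integrable_stdGaussian_iff.1 (hint3 i)
    have hG : ∀ v, HasFDerivAt (fun v => inner ℝ (b i) (g v))
        ((innerSL ℝ (b i)).comp (fderiv ℝ g v)) v := fun v =>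
      (innerSL ℝ (b i)).hasFDerivAt.comp v (hg v).hasFDerivAt
    have key := integral_bilinear_hasFDerivAt_right_eq_neg_left_of_integrable
      (μ := (volume : Measure E)) (f := (stdGaussianPDF : E → ℝ))
      (f' := fun v => -(stdGaussianPDF v) • innerSL ℝ v)
      (g := fun v => inner ℝ (b i) (g v)) (g' := fun v => (innerSL ℝ (b i)).comp (fderiv ℝ g v))
      (v := b i) (B := ContinuousLinearMap.mul ℝ ℝ)
      (h1.neg.congr (Filter.Eventually.of_forall fun v => by simp; ring))
      (h2.congr (Filter.Eventually.of_forall fun v => by simp))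
      (h3.congr (Filter.Eventually.of_forall fun v => by simp))
      (fun v _ => hasFDerivAt_stdGaussianPDF v) (fun v _ => hG v)
    rw [integral_stdGaussian_eq, integral_stdGaussian_eq]
    simp only [ContinuousLinearMap.mul_apply', ContinuousLinearMap.comp_apply,
      innerSL_apply_apply, FunLike.coe_smul, Pi.smul_apply, smul_eq_mul] at key
    rw [key, ← integral_neg]
    refine integral_congr_ae (Filter.Eventually.of_forall fun v => ?_)
    simp only
    ring
  simp_rw [hsum, htr]
  refine ⟨integrable_finsetSum _ fun i _ => hint1 i, integrable_finsetSum _ fun i _ => hint2 i, ?_⟩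
  rw [integral_finsetSum _ fun i _ => hint1 i, integral_finsetSum _ fun i _ => hint2 i]
  exact Finset.sum_congr rfl fun i _ => hibp i

theorem abs_stdGaussian_sub_preimage_le {Φ : E → E} (hbij : Function.Bijective Φ)
    (hΦ : Differentiable ℝ Φ) {a δ : ℝ} (ha0 : 0 < a) (ha : ∀ v, ‖Φ v - v‖ ≤ a)
    (hδ : ∀ v, ‖fderiv ℝ Φ v - 1‖ ≤ δ) (hδ5 : δ ≤ 1 / 5) {B : Set E} (hB : MeasurableSet B) :
    |(stdGaussian E).real B - (stdGaussian E).real (Φ ⁻¹' B)| ≤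
      √(a ^ 2 / 2 + Module.finrank ℝ E * δ ^ 2) := by
  set n : ℝ := (Module.finrank ℝ E : ℝ) with hn
  set g : E → E := fun v => Φ v - v with hg
  have hgd : Differentiable ℝ g := hΦ.sub differentiable_id
  have hfg : ∀ v, fderiv ℝ g v = fderiv ℝ Φ v - 1 := fun v => by
    rw [hg, fderiv_fun_sub (hΦ v) differentiableAt_fun_id, fderiv_fun_id]
    rfl
  have hδg : ∀ v, ‖fderiv ℝ g v‖ ≤ δ := fun v => by rw [hfg]; exact hδ v
  obtain ⟨hI1, hI2, hI⟩ := integral_inner_stdGaussian hgd ha hδg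
  -- `R` is the density, relative to the Gaussian, of its image under `Φ⁻¹`: its integral over `C`
  -- is the Gaussian mass of `Φ '' C`.
  set R : E → ℝ := fun v => |(fderiv ℝ Φ v).det| * (stdGaussianPDF (Φ v) / stdGaussianPDF v) with hR
  have hR0 : ∀ v, 0 ≤ R v := fun v => by
    have := stdGaussianPDF_pos v
    have := stdGaussianPDF_pos (Φ v)
    rw [hR]; positivity
  have hpR : ∀ v, stdGaussianPDF v * R v = |(fderiv ℝ Φ v).det| • stdGaussianPDF (Φ v) := fun v => by
    have := (stdGaussianPDF_pos v).ne'
    simp only [hR, smul_eq_mul]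
    field_simp
  have hRint : Integrable R (stdGaussian E) := by
    rw [integrable_stdGaussian_iff]
    simp_rw [hpR]
    rw [← integrableOn_univ, ← integrableOn_image_iff_integrableOn_abs_det_fderiv_smul volume
      MeasurableSet.univ (fun v _ => (hΦ v).hasFDerivAt.hasFDerivWithinAt) hbij.1.injOn,
      Set.image_univ, hbij.2.range_eq, integrableOn_univ]
    exact integrable_stdGaussianPDF
  have hreal : ∀ C : Set E, MeasurableSet C → ∫ v in C, R v ∂stdGaussian E =
      (stdGaussian E).real (Φ '' C) := by
    intro C hC
    have hC' : MeasurableSet (Φ '' C) := by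
      exact measurable_image_of_fderivWithin hC
        (fun v _ => (hΦ v).hasFDerivAt.hasFDerivWithinAt) hbij.1.injOn
    rw [← integral_indicator_one hC', ← integral_indicator hC, integral_stdGaussian_eq,
      integral_stdGaussian_eq]
    have h1 : ∀ v, stdGaussianPDF v * C.indicator R v =
        C.indicator (fun v => |(fderiv ℝ Φ v).det| • stdGaussianPDF (Φ v)) v := fun v => by
      by_cases hv : v ∈ C <;> simp only [Set.indicator, hv, if_true, if_false, hpR, mul_zero]
    have h2 : ∀ v, stdGaussianPDF v * (Φ '' C).indicator (1 : E → ℝ) v =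
        (Φ '' C).indicator stdGaussianPDF v := fun v => by
      by_cases hv : v ∈ Φ '' C <;> simp only [Set.indicator, hv, if_true, if_false] <;> simp
    simp_rw [h1, h2]
    rw [integral_indicator hC, integral_indicator hC',
      integral_image_eq_integral_abs_det_fderiv_smul volume hC
        (fun v _ => (hΦ v).hasFDerivAt.hasFDerivWithinAt) hbij.1.injOn]
  set X : E → ℝ := fun v => √(R v) with hX
  have hXsq : ∀ v, X v ^ 2 = R v := fun v => Real.sq_sqrt (hR0 v)
  have hXint : Integrable X (stdGaussian E) := by
    refine Integrable.mono' ((hRint.add (integrable_const 1))) ?_ ?_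
    · exact (Real.continuous_sqrt.comp_aestronglyMeasurable hRint.1)
    · refine Filter.Eventually.of_forall fun v => ?_
      rw [Real.norm_of_nonneg (Real.sqrt_nonneg _)]
      simp only [Pi.add_apply]
      nlinarith [sq_nonneg (X v - 1), hXsq v]
  set K : ℝ := a ^ 2 / 2 + n * δ ^ 2 with hK
  have hK0 : 0 < K := by positivity
  -- The determinant contributes `n δ²` to `K` and the term `‖g‖² / 2` of the Gaussian exponent
  -- contributes `a² / 2`. What remains is linear in `g` and has mean zero by Stein's identity.
  have hlow : ∀ v, 1 - K / 2 + (LinearMap.trace ℝ E (fderiv ℝ g v : E →ₗ[ℝ] E) -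
      inner ℝ v (g v)) / 2 ≤ X v := by
    intro v
    set τ := LinearMap.trace ℝ E (fderiv ℝ g v : E →ₗ[ℝ] E)
    have h1 := exp_trace_sub_le_abs_det (fderiv ℝ g v) (hδg v) hδ5
    rw [show (1 : E →L[ℝ] E) + fderiv ℝ g v = fderiv ℝ Φ v by rw [hfg]; abel] at h1
    have h2 : stdGaussianPDF (Φ v) / stdGaussianPDF v =
        Real.exp (-(inner ℝ v (g v)) - ‖g v‖ ^ 2 / 2) := by
      have h3 : Φ v = v + g v := by simp [hg]
      have h4 : ((2 * Real.pi) ^ ((Module.finrank ℝ E : ℝ) / 2)) ≠ 0 := by positivity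
      rw [h3, stdGaussianPDF, stdGaussianPDF, mul_div_mul_left _ _ (inv_ne_zero h4),
        ← Real.exp_sub, norm_add_sq_real]
      congr 1
      ring
    have h5 : Real.exp (τ - inner ℝ v (g v) - K) ≤ R v := by
      rw [hR]
      simp only
      rw [h2]
      refine le_trans ?_ (mul_le_mul_of_nonneg_right h1 (Real.exp_nonneg _))
      rw [← Real.exp_add, Real.exp_le_exp]
      have : ‖g v‖ ^ 2 ≤ a ^ 2 := by gcongr; exact ha v
      rw [hK]
      linarith
    have h6 : Real.exp ((τ - inner ℝ v (g v) - K) / 2) ≤ X v := by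
      rw [Real.exp_half]
      exact Real.sqrt_le_sqrt h5
    have h7 := Real.add_one_le_exp ((τ - inner ℝ v (g v) - K) / 2)
    linarith
  have hE : 1 - K / 2 ≤ ∫ v, X v ∂stdGaussian E := by
    have hI3 : Integrable (fun v => (LinearMap.trace ℝ E (fderiv ℝ g v : E →ₗ[ℝ] E) -
      inner ℝ v (g v)) / 2) (stdGaussian E) := (hI2.sub hI1).div_const 2
    refine le_trans (le_of_eq ?_)
      (integral_mono ((integrable_const (1 - K / 2)).add hI3) hXint hlow)
    simp only [Pi.add_apply]
    rw [integral_add (integrable_const _) hI3, integral_div, integral_sub hI2 hI1, hI]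
    simp
  have hone : ∫ v, X v ^ 2 ∂stdGaussian E = 1 := by
    simp_rw [hXsq]
    rw [← setIntegral_univ, hreal _ MeasurableSet.univ, Set.image_univ, hbij.2.range_eq]
    simp
  have hmeas : MeasurableSet (Φ ⁻¹' B) := hΦ.continuous.measurable hB
  have key := abs_setIntegral_sq_sub_measureReal_le (stdGaussian E)
    (hRint.congr (Filter.Eventually.of_forall fun v => (hXsq v).symm)) hXint
    (fun v => Real.sqrt_nonneg _) hone hK0 hE hmeas
  simp_rw [hXsq] at key
  rwa [hreal _ hmeas, Set.image_preimage_eq _ hbij.2] at key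

end Gaussian

/-! ### Stability of the Verlet recursion with an abstract force. -/

section Recursion

variable {V : Type*} [NormedAddCommGroup V] [NormedSpace ℝ V] {q v f : ℕ → V} {h : ℝ}

/-- Verlet is exact for a constant force, so the bounds are those of uniformly accelerated motion,
and the induction closes with no discretisation error. The space `V` is general because the
recursion is used both for positions and for derivatives with values in operators. -/
theorem norm_verlet_sub_le_of_force_le (hh : 0 ≤ h)
    (hq : ∀ k, q (k + 1) = q k + h • v k - (h ^ 2 / 2) • f k)
    (hv : ∀ k, v (k + 1) = v k - (h / 2) • (f k + f (k + 1))) {N : ℕ} {a : ℝ}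
    (hf : ∀ j ≤ N, ‖f j‖ ≤ a) (k : ℕ) (hk : k ≤ N) :
    ‖q k - q 0 - (k * h) • v 0‖ ≤ (k * h) ^ 2 / 2 * a ∧ ‖v k - v 0‖ ≤ k * h * a := by
  induction k with
  | zero => simp
  | succ k ih =>
    obtain ⟨h1, h2⟩ := ih (by omega)
    have hfk := hf k (by omega)
    have hfk' := hf (k + 1) hk
    constructor
    · have : q (k + 1) - q 0 - ((k + 1 : ℕ) * h) • v 0 =
          (q k - q 0 - (k * h) • v 0) + h • (v k - v 0) - (h ^ 2 / 2) • f k := by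
        rw [hq]; push_cast; module
      rw [this]
      refine (norm_sub_le _ _).trans ((add_le_add_left (norm_add_le _ _) _).trans ?_)
      rw [norm_smul, norm_smul, Real.norm_of_nonneg hh, Real.norm_of_nonneg (by positivity)]
      have h3 := mul_le_mul_of_nonneg_left h2 hh
      have h4 := mul_le_mul_of_nonneg_left hfk (by positivity : 0 ≤ h ^ 2 / 2)
      push_cast
      linarith
    · have : v (k + 1) - v 0 = (v k - v 0) - (h / 2) • (f k + f (k + 1)) := by
        rw [hv]; abel
      rw [this]
      refine (norm_sub_le _ _).trans ?_
      rw [norm_smul, Real.norm_of_nonneg (by positivity : 0 ≤ h / 2)]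
      have h3 := mul_le_mul_of_nonneg_left ((norm_add_le (f k) (f (k + 1))).trans
        (add_le_add hfk hfk')) (by positivity : 0 ≤ h / 2)
      push_cast
      linarith

/-- A maximum argument replaces Grönwall. If `S` is the largest `‖q j‖`, the force moves `q` by at
most `S / 12 + T² b / 2`; hence `S ≤ 12/11 (‖q 0‖ + T ‖v 0‖) + 6/11 T² b`, which is put back into
the same bound. -/
theorem norm_verlet_sub_le_of_force_le_affine (hh : 0 ≤ h)
    (hq : ∀ k, q (k + 1) = q k + h • v k - (h ^ 2 / 2) • f k)
    (hv : ∀ k, v (k + 1) = v k - (h / 2) • (f k + f (k + 1))) {N : ℕ} {L b : ℝ}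
    (hL : 0 ≤ L) (hb : 0 ≤ b) (hf : ∀ j ≤ N, ‖f j‖ ≤ L * ‖q j‖ + b)
    (hLT : L * (N * h) ^ 2 ≤ 1 / 6) {k : ℕ} (hk : k ≤ N) :
    ‖q k - q 0 - (k * h) • v 0‖ ≤
      1 / 11 * (‖q 0‖ + N * h * ‖v 0‖) + 6 / 11 * (N * h) ^ 2 * b := by
  obtain ⟨m, hm, hmax⟩ := Finset.exists_max_image (Finset.range (N + 1)) (fun j => ‖q j‖) (by simp)
  simp only [Finset.mem_range, Nat.lt_succ_iff] at hm hmax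
  set S := ‖q m‖ with hS
  have hS0 : 0 ≤ S := norm_nonneg _
  have hf' : ∀ j ≤ N, ‖f j‖ ≤ L * S + b := fun j hj =>
    (hf j hj).trans (by gcongr; exact hmax j hj)
  have hT0 : 0 ≤ N * h := by positivity
  have key : ∀ j ≤ N, ‖q j - q 0 - (j * h) • v 0‖ ≤ 1 / 12 * S + (N * h) ^ 2 / 2 * b := by
    intro j hj
    refine (norm_verlet_sub_le_of_force_le hh hq hv hf' j hj).1.trans ?_
    have h1 : (j * h : ℝ) ≤ N * h := by gcongr
    have h2 : (j * h : ℝ) ^ 2 / 2 * (L * S + b) ≤ (N * h) ^ 2 / 2 * (L * S + b) := by gcongr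
    have h3 := mul_le_mul_of_nonneg_right hLT hS0
    linarith
  have hSle : S ≤ ‖q 0‖ + N * h * ‖v 0‖ + (1 / 12 * S + (N * h) ^ 2 / 2 * b) := by
    have h1 : q m = q 0 + (m * h) • v 0 + (q m - q 0 - (m * h) • v 0) := by abel
    have h2 : ‖q m‖ ≤ ‖q 0‖ + ‖(m * h) • v 0‖ + ‖q m - q 0 - (m * h) • v 0‖ := by
      nth_rewrite 1 [h1]
      exact (norm_add_le _ _).trans (add_le_add_left (norm_add_le _ _) _)
    rw [norm_smul, Real.norm_of_nonneg (by positivity)] at h2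
    have h3 : (m * h : ℝ) * ‖v 0‖ ≤ N * h * ‖v 0‖ := by gcongr
    linarith [key m hm]
  linarith [key k hk]

end Recursion

/-! ### Dependence of the Verlet position on its initial data, and the velocity transport. -/

section Verlet

variable {d : ℕ} {U : EuclideanSpace ℝ (Fin d) → ℝ} {h : ℝ}

/-- The velocity after `N` velocity Verlet steps of size `h`. -/
noncomputable def verletVelocity {d : ℕ} (U : EuclideanSpace ℝ (Fin d) → ℝ) (h : ℝ) (N : ℕ)
    (z : EuclideanSpace ℝ (Fin d) × EuclideanSpace ℝ (Fin d)) : EuclideanSpace ℝ (Fin d) :=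
  ((verletStep U h)^[N] z).2

theorem verletPosition_succ (k : ℕ) (z : EuclideanSpace ℝ (Fin d) × EuclideanSpace ℝ (Fin d)) :
    verletPosition U h (k + 1) z = verletPosition U h k z + h • verletVelocity U h k z -
      (h ^ 2 / 2) • gradient U (verletPosition U h k z) := by
  simp only [verletPosition, verletVelocity, Function.iterate_succ_apply', verletStep]

theorem verletVelocity_succ (k : ℕ) (z : EuclideanSpace ℝ (Fin d) × EuclideanSpace ℝ (Fin d)) :
    verletVelocity U h (k + 1) z = verletVelocity U h k z - (h / 2) •
      (gradient U (verletPosition U h k z) + gradient U (verletPosition U h (k + 1) z)) := by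
  simp only [verletPosition, verletVelocity, Function.iterate_succ_apply', verletStep]

variable {N : ℕ} {L L_H : ℝ}

theorem norm_gradient_sub_le (hG : Differentiable ℝ (gradient U))
    (hL : ∀ x, ‖fderiv ℝ (gradient U) x‖ ≤ L) (x y : EuclideanSpace ℝ (Fin d)) :
    ‖gradient U x - gradient U y‖ ≤ L * ‖x - y‖ :=
  convex_univ.norm_image_sub_le_of_norm_fderiv_le (fun z _ => hG z) (fun z _ => hL z)
    (Set.mem_univ y) (Set.mem_univ x)

theorem norm_verletPosition_sub_sub_le (hG : Differentiable ℝ (gradient U))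
    (hL : ∀ x, ‖fderiv ℝ (gradient U) x‖ ≤ L) (hh : 0 ≤ h) (hLT : L * (N * h) ^ 2 ≤ 1 / 6)
    (x y v w : EuclideanSpace ℝ (Fin d)) {k : ℕ} (hk : k ≤ N) :
    ‖verletPosition U h k (x, v) - verletPosition U h k (y, w) - (x - y) - (k * h) • (v - w)‖ ≤
      1 / 11 * (‖x - y‖ + N * h * ‖v - w‖) := by
  have hL0 : 0 ≤ L := (norm_nonneg _).trans (hL 0)
  have := norm_verlet_sub_le_of_force_le_affine
    (q := fun k => verletPosition U h k (x, v) - verletPosition U h k (y, w))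
    (v := fun k => verletVelocity U h k (x, v) - verletVelocity U h k (y, w))
    (f := fun k => gradient U (verletPosition U h k (x, v)) -
      gradient U (verletPosition U h k (y, w))) hh
    (fun k => by simp only [verletPosition_succ]; module)
    (fun k => by simp only [verletVelocity_succ]; module)
    hL0 le_rfl (fun j _ => by simpa using norm_gradient_sub_le hG hL _ _) hLT hk
  simpa [verletPosition, verletVelocity] using this

theorem norm_verletPosition_sub_le (hG : Differentiable ℝ (gradient U))
    (hL : ∀ x, ‖fderiv ℝ (gradient U) x‖ ≤ L) (hh : 0 ≤ h) (hLT : L * (N * h) ^ 2 ≤ 1 / 6)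
    (x y v w : EuclideanSpace ℝ (Fin d)) {k : ℕ} (hk : k ≤ N) :
    ‖verletPosition U h k (x, v) - verletPosition U h k (y, w)‖ ≤
      12 / 11 * (‖x - y‖ + N * h * ‖v - w‖) := by
  have h1 := norm_verletPosition_sub_sub_le hG hL hh hLT x y v w hk
  have h2 : verletPosition U h k (x, v) - verletPosition U h k (y, w) =
      (verletPosition U h k (x, v) - verletPosition U h k (y, w) - (x - y) - (k * h) • (v - w)) +
      (x - y) + (k * h) • (v - w) := by abel
  rw [h2]
  refine (norm_add_le _ _).trans ((add_le_add_left (norm_add_le _ _) _).trans ?_)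
  rw [norm_smul, Real.norm_of_nonneg (by positivity)]
  have h3 : (k * h : ℝ) * ‖v - w‖ ≤ N * h * ‖v - w‖ := by gcongr
  linarith

theorem differentiable_verletStep (hG : Differentiable ℝ (gradient U)) :
    Differentiable ℝ (verletStep U h) := by
  unfold verletStep
  fun_prop

theorem differentiable_verletPosition (hG : Differentiable ℝ (gradient U)) (k : ℕ)
    (x : EuclideanSpace ℝ (Fin d)) : Differentiable ℝ fun v => verletPosition U h k (x, v) := by
  have := (differentiable_verletStep (h := h) hG).iterate k
  unfold verletPosition
  fun_prop

theorem differentiable_verletVelocity (hG : Differentiable ℝ (gradient U)) (k : ℕ)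
    (x : EuclideanSpace ℝ (Fin d)) : Differentiable ℝ fun v => verletVelocity U h k (x, v) := by
  have := (differentiable_verletStep (h := h) hG).iterate k
  unfold verletVelocity
  fun_prop

theorem hasFDerivAt_gradient_verletPosition (hG : Differentiable ℝ (gradient U)) (k : ℕ)
    (x v : EuclideanSpace ℝ (Fin d)) :
    HasFDerivAt (fun v => gradient U (verletPosition U h k (x, v)))
      (fderiv ℝ (gradient U) (verletPosition U h k (x, v)) *
        fderiv ℝ (fun v => verletPosition U h k (x, v)) v) v :=
  (hG _).hasFDerivAt.comp v (differentiable_verletPosition hG k x v).hasFDerivAt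

theorem fderiv_verletPosition_succ (hG : Differentiable ℝ (gradient U)) (k : ℕ)
    (x v : EuclideanSpace ℝ (Fin d)) :
    fderiv ℝ (fun v => verletPosition U h (k + 1) (x, v)) v =
      fderiv ℝ (fun v => verletPosition U h k (x, v)) v +
      h • fderiv ℝ (fun v => verletVelocity U h k (x, v)) v -
      (h ^ 2 / 2) • (fderiv ℝ (gradient U) (verletPosition U h k (x, v)) *
        fderiv ℝ (fun v => verletPosition U h k (x, v)) v) := by
  have := (((differentiable_verletPosition (h := h) hG k x v).hasFDerivAt.add
    ((differentiable_verletVelocity (h := h) hG k x v).hasFDerivAt.const_smul h)).sub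
    ((hasFDerivAt_gradient_verletPosition (h := h) hG k x v).const_smul (h ^ 2 / 2))).fderiv
  rw [← this]
  congr 1
  funext w
  exact verletPosition_succ k (x, w)

theorem fderiv_verletVelocity_succ (hG : Differentiable ℝ (gradient U)) (k : ℕ)
    (x v : EuclideanSpace ℝ (Fin d)) :
    fderiv ℝ (fun v => verletVelocity U h (k + 1) (x, v)) v =
      fderiv ℝ (fun v => verletVelocity U h k (x, v)) v - (h / 2) •
      (fderiv ℝ (gradient U) (verletPosition U h k (x, v)) *
        fderiv ℝ (fun v => verletPosition U h k (x, v)) v +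
      fderiv ℝ (gradient U) (verletPosition U h (k + 1) (x, v)) *
        fderiv ℝ (fun v => verletPosition U h (k + 1) (x, v)) v) := by
  have := ((differentiable_verletVelocity (h := h) hG k x v).hasFDerivAt.sub
    (((hasFDerivAt_gradient_verletPosition (h := h) hG k x v).add
      (hasFDerivAt_gradient_verletPosition (h := h) hG (k + 1) x v)).const_smul (h / 2))).fderiv
  rw [← this]
  congr 1
  funext w
  exact verletVelocity_succ k (x, w)

theorem norm_fderiv_verletPosition_le (hG : Differentiable ℝ (gradient U))
    (hL : ∀ x, ‖fderiv ℝ (gradient U) x‖ ≤ L) (hh : 0 ≤ h) (hLT : L * (N * h) ^ 2 ≤ 1 / 6)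
    (x v : EuclideanSpace ℝ (Fin d)) {k : ℕ} (hk : k ≤ N) :
    ‖fderiv ℝ (fun v => verletPosition U h k (x, v)) v‖ ≤ 12 / 11 * (N * h) := by
  refine norm_fderiv_le_of_lip' ℝ (by positivity) (Filter.Eventually.of_forall fun w => ?_)
  have := norm_verletPosition_sub_le hG hL hh hLT x x w v hk
  simp only [sub_self, norm_zero, zero_add] at this
  linarith

theorem norm_fderiv_verletPosition_sub_le (hG : Differentiable ℝ (gradient U))
    (hL : ∀ x, ‖fderiv ℝ (gradient U) x‖ ≤ L) (hh : 0 ≤ h) (hLT : L * (N * h) ^ 2 ≤ 1 / 6)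
    (x v : EuclideanSpace ℝ (Fin d)) :
    ‖fderiv ℝ (fun v => verletPosition U h N (x, v)) v - (N * h) • 1‖ ≤ 1 / 11 * (N * h) := by
  have h0 : HasFDerivAt (fun v : EuclideanSpace ℝ (Fin d) => (N * h : ℝ) • v)
      ((N * h : ℝ) • (1 : EuclideanSpace ℝ (Fin d) →L[ℝ] EuclideanSpace ℝ (Fin d))) v :=
    (hasFDerivAt_id v).const_smul (N * h : ℝ)
  have h1 : HasFDerivAt (fun v => verletPosition U h N (x, v) - (N * h) • v)
      (fderiv ℝ (fun v => verletPosition U h N (x, v)) v - (N * h) • 1) v :=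
    (differentiable_verletPosition hG N x v).hasFDerivAt.sub h0
  refine h1.le_of_lip' (by positivity) (Filter.Eventually.of_forall fun w => ?_)
  have := norm_verletPosition_sub_sub_le hG hL hh hLT x x w v le_rfl
  simp only [sub_self, norm_zero, zero_add, sub_zero] at this
  refine le_trans (le_of_eq ?_) (this.trans (by linarith))
  congr 1
  module

/-- The velocity derivatives obey the linearised recursion, and the difference of two of them starts
from zero. It is driven only by the change of the Hessian between the trajectories, so the constant
is `6/11 · (12/11)²`. -/
theorem norm_fderiv_verletPosition_sub_fderiv_le (hG : Differentiable ℝ (gradient U))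
    (hL : ∀ x, ‖fderiv ℝ (gradient U) x‖ ≤ L) (hL_H : 0 ≤ L_H)
    (hH : ∀ x y, ‖fderiv ℝ (gradient U) x - fderiv ℝ (gradient U) y‖ ≤ L_H * ‖x - y‖)
    (hh : 0 ≤ h) (hLT : L * (N * h) ^ 2 ≤ 1 / 6) (x y v w : EuclideanSpace ℝ (Fin d)) :
    ‖fderiv ℝ (fun v => verletPosition U h N (x, v)) v -
        fderiv ℝ (fun v => verletPosition U h N (y, v)) w‖ ≤
      864 / 1331 * L_H * (N * h) ^ 3 * (‖x - y‖ + N * h * ‖v - w‖) := by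
  have hL0 : 0 ≤ L := (norm_nonneg _).trans (hL 0)
  have hT0 : 0 ≤ N * h := by positivity
  set M := ‖x - y‖ + N * h * ‖v - w‖ with hM
  have hM0 : 0 ≤ M := by positivity
  have := norm_verlet_sub_le_of_force_le_affine (N := N) (L := L)
    (b := L_H * (12 / 11 * M) * (12 / 11 * (N * h))) (k := N)
    (q := fun k => fderiv ℝ (fun v => verletPosition U h k (x, v)) v -
        fderiv ℝ (fun v => verletPosition U h k (y, v)) w)
    (v := fun k => fderiv ℝ (fun v => verletVelocity U h k (x, v)) v -
        fderiv ℝ (fun v => verletVelocity U h k (y, v)) w)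
    (f := fun k => fderiv ℝ (gradient U) (verletPosition U h k (x, v)) *
        fderiv ℝ (fun v => verletPosition U h k (x, v)) v -
        fderiv ℝ (gradient U) (verletPosition U h k (y, w)) *
        fderiv ℝ (fun v => verletPosition U h k (y, v)) w) hh
    (fun k => by simp only [fderiv_verletPosition_succ hG]; module)
    (fun k => by simp only [fderiv_verletVelocity_succ hG]; module)
    hL0 (by positivity) (fun j hj => ?_) hLT le_rfl
  · have h0 : fderiv ℝ (fun v => verletPosition U h 0 (x, v)) v -
        fderiv ℝ (fun v => verletPosition U h 0 (y, v)) w = 0 := by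
      simp [verletPosition]
    have h0' : fderiv ℝ (fun v => verletVelocity U h 0 (x, v)) v -
        fderiv ℝ (fun v => verletVelocity U h 0 (y, v)) w = 0 := by
      simp [verletVelocity]
    simp only [h0, h0', smul_zero, sub_zero, norm_zero, mul_zero, add_zero, zero_add] at this
    refine this.trans (le_of_eq ?_)
    ring
  · have hsplit : ∀ A B C D : EuclideanSpace ℝ (Fin d) →L[ℝ] EuclideanSpace ℝ (Fin d),
        A * B - C * D = A * (B - D) + (A - C) * D := fun A B C D => by
          rw [mul_sub, sub_mul]; abel
    simp only [hsplit]
    refine (norm_add_le _ _).trans (add_le_add ((norm_mul_le _ _).trans ?_)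
      ((norm_mul_le _ _).trans ?_))
    · gcongr
      exact hL _
    · refine mul_le_mul ((hH _ _).trans ?_) (norm_fderiv_verletPosition_le hG hL hh hLT y w hj)
        (norm_nonneg _) (by positivity)
      gcongr
      exact norm_verletPosition_sub_le hG hL hh hLT x y v w hj

theorem mul_norm_le_norm_fderiv_verletPosition (hG : Differentiable ℝ (gradient U))
    (hL : ∀ x, ‖fderiv ℝ (gradient U) x‖ ≤ L) (hh : 0 ≤ h) (hLT : L * (N * h) ^ 2 ≤ 1 / 6)
    (x v u : EuclideanSpace ℝ (Fin d)) :
    10 / 11 * (N * h) * ‖u‖ ≤ ‖fderiv ℝ (fun v => verletPosition U h N (x, v)) v u‖ := by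
  set A := fderiv ℝ (fun v => verletPosition U h N (x, v)) v
  have hT0 : 0 ≤ N * h := by positivity
  have h1 := (A - ((N * h : ℝ) • 1)).le_of_opNorm_le
    (norm_fderiv_verletPosition_sub_le hG hL hh hLT x v) u
  have h2 : (N * h : ℝ) • u = A u - (A - ((N * h : ℝ) • 1)) u := by simp
  have h3 : ‖(N * h : ℝ) • u‖ ≤ ‖A u‖ + ‖(A - ((N * h : ℝ) • 1)) u‖ := by
    rw [h2]; exact norm_sub_le _ _
  rw [norm_smul, Real.norm_of_nonneg hT0] at h3
  linarith

/-- The map is a `T/11`-Lipschitz perturbation of `T • id`, so the global quantitative inverse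
function theorem applies. The inverse is differentiable because the derivative is bounded below. -/
theorem exists_homeomorph_verletPosition (hG : Differentiable ℝ (gradient U))
    (hL : ∀ x, ‖fderiv ℝ (gradient U) x‖ ≤ L) (hh : 0 ≤ h) (hT : 0 < N * h)
    (hLT : L * (N * h) ^ 2 ≤ 1 / 6) (x : EuclideanSpace ℝ (Fin d)) :
    ∃ e : EuclideanSpace ℝ (Fin d) ≃ₜ EuclideanSpace ℝ (Fin d),
      (∀ v, e v = verletPosition U h N (x, v)) ∧ Differentiable ℝ e.symm := by
  let f' : EuclideanSpace ℝ (Fin d) ≃L[ℝ] EuclideanSpace ℝ (Fin d) :=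
    ContinuousLinearEquiv.smulLeft (Units.mk0 (N * h) hT.ne')
  have hf' : ∀ u, f' u = (N * h : ℝ) • u := fun u => rfl
  have hsymm : ∀ u, f'.symm u = (N * h : ℝ)⁻¹ • u := fun u => by
    rw [ContinuousLinearEquiv.symm_apply_eq, hf', smul_smul, mul_inv_cancel₀ hT.ne', one_smul]
  have hc0 : (0 : ℝ) < 1 / 11 * (N * h) := by positivity
  let c : NNReal := (1 / 11 * (N * h) : ℝ).toNNReal
  have hcc : (c : ℝ) = 1 / 11 * (N * h) := Real.coe_toNNReal _ hc0.le
  have happ : ApproximatesLinearOn (fun v => verletPosition U h N (x, v))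
      (f' : EuclideanSpace ℝ (Fin d) →L[ℝ] EuclideanSpace ℝ (Fin d)) Set.univ c := by
    intro v _ w _
    have := norm_verletPosition_sub_sub_le hG hL hh hLT x x v w le_rfl
    simp only [sub_self, norm_zero, zero_add, sub_zero] at this
    refine this.trans (le_of_eq ?_)
    rw [hcc]
    ring
  have hc : Subsingleton (EuclideanSpace ℝ (Fin d)) ∨
      c < ‖(f'.symm : EuclideanSpace ℝ (Fin d) →L[ℝ] EuclideanSpace ℝ (Fin d))‖₊⁻¹ := by
    rcases subsingleton_or_nontrivial (EuclideanSpace ℝ (Fin d)) with hs | hs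
    · exact Or.inl hs
    · right
      have hpos : 0 < ‖(f'.symm : EuclideanSpace ℝ (Fin d) →L[ℝ] EuclideanSpace ℝ (Fin d))‖₊ :=
        f'.nnnorm_symm_pos
      rw [lt_inv_comm₀ (by rw [← NNReal.coe_pos, hcc]; exact hc0) hpos]
      rw [← NNReal.coe_lt_coe, NNReal.coe_inv, hcc, coe_nnnorm]
      have hle : ‖(f'.symm : EuclideanSpace ℝ (Fin d) →L[ℝ] EuclideanSpace ℝ (Fin d))‖ ≤
          (N * h : ℝ)⁻¹ := by
        refine ContinuousLinearMap.opNorm_le_bound _ (by positivity) fun u => ?_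
        rw [ContinuousLinearEquiv.coe_coe, hsymm, norm_smul, Real.norm_of_nonneg (by positivity)]
      exact hle.trans_lt (inv_strictAnti₀ hc0 (by linarith))
  refine ⟨happ.toHomeomorph _ hc, fun v => rfl, fun z => ?_⟩
  set e := happ.toHomeomorph _ hc
  have he : ∀ v, e v = verletPosition U h N (x, v) := fun v => rfl
  set A := fderiv ℝ (fun v => verletPosition U h N (x, v)) (e.symm z) with hA
  have hinj : Function.Injective (A : EuclideanSpace ℝ (Fin d) →ₗ[ℝ] EuclideanSpace ℝ (Fin d)) := by
    rw [injective_iff_map_eq_zero]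
    intro u hu
    have := mul_norm_le_norm_fderiv_verletPosition hG hL hh hLT x (e.symm z) u
    rw [show fderiv ℝ (fun v => verletPosition U h N (x, v)) (e.symm z) u = 0 from hu,
      norm_zero] at this
    have h2 : 0 < 10 / 11 * (N * h : ℝ) := by positivity
    exact norm_le_zero_iff.1 (nonpos_of_mul_nonpos_right this h2)
  let A' := (LinearEquiv.ofInjectiveEndo _ hinj).toContinuousLinearEquiv
  have hA' : (A' : EuclideanSpace ℝ (Fin d) →L[ℝ] EuclideanSpace ℝ (Fin d)) = A := by
    ext1 u; rfl
  have hd : HasFDerivAt (fun v => verletPosition U h N (x, v))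
      (A' : EuclideanSpace ℝ (Fin d) →L[ℝ] EuclideanSpace ℝ (Fin d)) (e.symm z) := by
    rw [hA']
    exact (differentiable_verletPosition hG N x _).hasFDerivAt
  exact (hd.of_local_left_inverse e.symm.continuous.continuousAt
    (Filter.Eventually.of_forall fun z => by rw [← he]; simp)).differentiableAt

/-- `Φ` is the position map from `x` followed by the inverse of that from `y`. With `A_x`, `A_y` the
velocity derivatives at `v` and `Φ v`, `DΦ - 1 = A_y⁻¹ (A_x - A_y)` and `‖A_y⁻¹‖ ≤ 11 / (10 T)`.
Both `A_x` and `A_y` are within `T/11` of `T • 1`, whence `1/5`; the Hessian Lipschitz bound gives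
the estimate proportional to `‖x - y‖`. -/
theorem exists_velocity_transport (hG : Differentiable ℝ (gradient U))
    (hL : ∀ x, ‖fderiv ℝ (gradient U) x‖ ≤ L) (hL_H : 0 ≤ L_H)
    (hH : ∀ x y, ‖fderiv ℝ (gradient U) x - fderiv ℝ (gradient U) y‖ ≤ L_H * ‖x - y‖)
    (hh : 0 ≤ h) (hT : 0 < N * h) (hLT : L * (N * h) ^ 2 ≤ 1 / 6)
    (x y : EuclideanSpace ℝ (Fin d)) :
    ∃ Φ : EuclideanSpace ℝ (Fin d) → EuclideanSpace ℝ (Fin d),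
      Function.Bijective Φ ∧ Differentiable ℝ Φ ∧
      (∀ v, verletPosition U h N (y, Φ v) = verletPosition U h N (x, v)) ∧
      (∀ v, ‖Φ v - v‖ ≤ 6 / 5 * ‖x - y‖ / (N * h)) ∧
      (∀ v, ‖fderiv ℝ Φ v - 1‖ ≤ 1 / 5) ∧
      (∀ v, ‖fderiv ℝ Φ v - 1‖ ≤ 8 / 5 * L_H * (N * h) ^ 2 * ‖x - y‖) := by
  obtain ⟨ex, hex, -⟩ := exists_homeomorph_verletPosition hG hL hh hT hLT x
  obtain ⟨ey, hey, hdey⟩ := exists_homeomorph_verletPosition hG hL hh hT hLT y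
  have hFx := differentiable_verletPosition (h := h) hG N x
  have hFy := differentiable_verletPosition (h := h) hG N y
  have hdΦ : Differentiable ℝ fun v => ey.symm (ex v) := by
    simp_rw [hex]
    exact hdey.comp hFx
  have hfun : ∀ v, verletPosition U h N (y, ey.symm (ex v)) = verletPosition U h N (x, v) :=
    fun v => by rw [← hey, ← hex]; simp
  have hclose : ∀ v, ‖ey.symm (ex v) - v‖ ≤ 6 / 5 * ‖x - y‖ / (N * h) := by
    intro v
    have h1 := norm_verletPosition_sub_sub_le hG hL hh hLT y x (ey.symm (ex v)) v le_rfl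
    rw [hfun, sub_self, zero_sub, ← neg_add', norm_neg] at h1
    have h2 : ‖(N * h : ℝ) • (ey.symm (ex v) - v)‖ ≤
        ‖y - x + (N * h : ℝ) • (ey.symm (ex v) - v)‖ + ‖y - x‖ := by
      have := norm_sub_le (y - x + (N * h : ℝ) • (ey.symm (ex v) - v)) (y - x)
      rwa [add_sub_cancel_left] at this
    rw [norm_smul, Real.norm_of_nonneg hT.le] at h2
    rw [le_div_iff₀ hT, norm_sub_rev x y]
    linarith
  have hchain : ∀ v, fderiv ℝ (fun v => verletPosition U h N (y, v)) (ey.symm (ex v)) *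
      fderiv ℝ (fun v => ey.symm (ex v)) v = fderiv ℝ (fun v => verletPosition U h N (x, v)) v := by
    intro v
    have h1 := ((hFy (ey.symm (ex v))).hasFDerivAt.comp v (hdΦ v).hasFDerivAt).fderiv
    rw [show (fun v => verletPosition U h N (y, v)) ∘ (fun v => ey.symm (ex v)) =
      fun v => verletPosition U h N (x, v) from funext hfun] at h1
    exact h1.symm
  have hop : ∀ (v : EuclideanSpace ℝ (Fin d)) (C : ℝ), 0 ≤ C →
      ‖fderiv ℝ (fun v => verletPosition U h N (x, v)) v -
        fderiv ℝ (fun v => verletPosition U h N (y, v)) (ey.symm (ex v))‖ ≤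
        10 / 11 * (N * h) * C →
      ‖fderiv ℝ (fun v => ey.symm (ex v)) v - 1‖ ≤ C := by
    intro v C hC hle
    refine ContinuousLinearMap.opNorm_le_bound _ hC fun u => ?_
    set A := fderiv ℝ (fun v => verletPosition U h N (y, v)) (ey.symm (ex v)) with hA
    have h1 := mul_norm_le_norm_fderiv_verletPosition hG hL hh hLT y (ey.symm (ex v))
      ((fderiv ℝ (fun v => ey.symm (ex v)) v - 1) u)
    have h2 : A ((fderiv ℝ (fun v => ey.symm (ex v)) v - 1) u) =
        (fderiv ℝ (fun v => verletPosition U h N (x, v)) v - A) u := by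
      rw [← hchain v]
      simp [hA]
    rw [← hA, h2] at h1
    have h3 := ContinuousLinearMap.le_of_opNorm_le _ hle u
    have h4 : 0 < 10 / 11 * (N * h : ℝ) := by positivity
    rw [mul_assoc] at h3
    exact le_of_mul_le_mul_left (h1.trans h3) h4
  refine ⟨fun v => ey.symm (ex v), ey.symm.bijective.comp ex.bijective, hdΦ, hfun, hclose,
    fun v => hop v _ (by norm_num) ?_, fun v => hop v _ (by positivity) ?_⟩
  · have h1 := norm_fderiv_verletPosition_sub_le hG hL hh hLT x v
    have h2 := norm_fderiv_verletPosition_sub_le hG hL hh hLT y (ey.symm (ex v))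
    have h3 := norm_sub_le_norm_sub_add_norm_sub
      (fderiv ℝ (fun v => verletPosition U h N (x, v)) v) ((N * h : ℝ) • 1)
      (fderiv ℝ (fun v => verletPosition U h N (y, v)) (ey.symm (ex v)))
    rw [norm_sub_rev ((N * h : ℝ) • 1)] at h3
    linarith
  · refine (norm_fderiv_verletPosition_sub_fderiv_le hG hL hL_H hH hh hLT x y v _).trans ?_
    have h1 := hclose v
    rw [norm_sub_rev, le_div_iff₀ hT] at h1
    -- `11/5 = 1 + 6/5`, and `864/1331 · 11/5 · 11/10 ≤ 8/5`.
    have h2 : ‖x - y‖ + N * h * ‖v - ey.symm (ex v)‖ ≤ 11 / 5 * ‖x - y‖ := by linarith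
    have h3 : 864 / 1331 * L_H * (N * h) ^ 3 * (‖x - y‖ + N * h * ‖v - ey.symm (ex v)‖) ≤
        864 / 1331 * L_H * (N * h) ^ 3 * (11 / 5 * ‖x - y‖) := by gcongr
    have h4 : 0 ≤ L_H * (N * h) ^ 3 * ‖x - y‖ := by positivity
    linarith

end Verlet

/-! ### Wasserstein distance: smoothing by a kernel and a dual lower bound. -/

section Wasserstein

theorem wassersteinOne_le_lintegral {E : Type*} [MeasurableSpace E] [PseudoEMetricSpace E]
    {ν η : Measure E} {γ : Measure (E × E)} (hγ : IsCoupling γ ν η) :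
    wassersteinOne ν η ≤ ∫⁻ p, edist p.1 p.2 ∂γ :=
  iInf₂_le γ hγ

theorem wassersteinOne_comm {E : Type*} [MeasurableSpace E] [PseudoEMetricSpace E]
    [OpensMeasurableSpace E] [SecondCountableTopology E] (ν η : Measure E) :
    wassersteinOne ν η = wassersteinOne η ν := by
  suffices h : ∀ ν η : Measure E, wassersteinOne ν η ≤ wassersteinOne η ν from
    le_antisymm (h _ _) (h _ _)
  intro ν η
  refine le_iInf₂ fun γ hγ => ?_
  have hswap : IsCoupling (γ.map Prod.swap) ν η := by
    constructor
    · rw [Measure.map_map measurable_fst measurable_swap]; exact hγ.2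
    · rw [Measure.map_map measurable_snd measurable_swap]; exact hγ.1
  refine (wassersteinOne_le_lintegral hswap).trans ?_
  rw [lintegral_map measurable_edist measurable_swap]
  simp [edist_comm]

theorem tvDist_bind_le {E : Type*} [MeasurableSpace E] [PseudoMetricSpace E]
    (κ : Kernel E E) [IsMarkovKernel κ] {C : ℝ} (hC : 0 < C)
    (hκ : ∀ x y A, MeasurableSet A → |(κ x).real A - (κ y).real A| ≤ C * dist x y)
    (ν η : Measure E) [IsProbabilityMeasure ν] [IsProbabilityMeasure η] :
    tvDist (ν.bind κ) (η.bind κ) ≤ ENNReal.ofReal C * wassersteinOne ν η := by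
  have hC0 : ENNReal.ofReal C ≠ 0 := (ENNReal.ofReal_pos.2 hC).ne'
  unfold tvDist wassersteinOne
  refine iSup₂_le fun A hA => ?_
  simp_rw [ENNReal.mul_iInf_of_ne hC0 ENNReal.ofReal_ne_top]
  refine le_iInf₂ fun γ hγ => ?_
  have hm : Measurable fun x => (κ x).real A := (κ.measurable_coe hA).ennreal_toReal
  have hreal : ∀ m : Measure E, (m.bind κ).real A = ∫ x, (κ x).real A ∂m := fun m => by
    rw [measureReal_def, Measure.bind_apply hA κ.aemeasurable,
      ← integral_toReal (κ.measurable_coe hA).aemeasurable (by simp)]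
    rfl
  have : IsProbabilityMeasure γ := by
    have h1 := measure_univ (μ := ν)
    rw [← hγ.1, Measure.map_apply measurable_fst MeasurableSet.univ, Set.preimage_univ] at h1
    exact ⟨h1⟩
  have hint : ∀ f : E × E → E, Measurable f → Integrable (fun p => (κ (f p)).real A) γ := by
    intro f hf
    refine Integrable.of_bound (hm.comp hf).aestronglyMeasurable 1
      (Filter.Eventually.of_forall fun p => ?_)
    rw [Real.norm_of_nonneg measureReal_nonneg]
    exact measureReal_le_one
  have h1 : ∫ x, (κ x).real A ∂ν = ∫ p, (κ p.1).real A ∂γ := by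
    rw [← hγ.1, integral_map measurable_fst.aemeasurable hm.aestronglyMeasurable]
  have h2 : ∫ x, (κ x).real A ∂η = ∫ p, (κ p.2).real A ∂γ := by
    rw [← hγ.2, integral_map measurable_snd.aemeasurable hm.aestronglyMeasurable]
  rw [hreal, hreal, h1, h2, ← integral_sub (hint _ measurable_fst) (hint _ measurable_snd),
    ← Real.enorm_eq_ofReal_abs, ← lintegral_const_mul' _ _ ENNReal.ofReal_ne_top]
  refine (enorm_integral_le_lintegral_enorm _).trans (lintegral_mono fun p => ?_)
  rw [Real.enorm_eq_ofReal_abs, edist_dist, ← ENNReal.ofReal_mul hC.le]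
  exact ENNReal.ofReal_le_ofReal (hκ _ _ _ hA)

theorem abs_clamp_sub_clamp_le (n s t : ℝ) :
    |max (-n) (min n s) - max (-n) (min n t)| ≤ |s - t| := by
  rw [max_comm (-n), max_comm (-n)]
  refine (abs_max_sub_max_le_abs _ _ _).trans ?_
  simpa using abs_min_sub_min_le_max n s n t

theorem abs_clamp_le {n : ℝ} (hn : 0 ≤ n) (s : ℝ) :
    |max (-n) (min n s)| ≤ |s| ∧ |max (-n) (min n s)| ≤ n := by
  constructor
  · simpa [hn] using abs_clamp_sub_clamp_le n s 0
  · rw [abs_le]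
    exact ⟨le_max_left _ _, max_le (by linarith) (min_le_left _ _)⟩

theorem integrable_clamp {Z : Type*} [MeasurableSpace Z] {n : ℝ} (hn : 0 ≤ n) (m : Measure Z)
    [IsFiniteMeasure m] {f : Z → ℝ} (hf : Measurable f) :
    Integrable (fun z => max (-n) (min n (f z))) m :=
  Integrable.of_bound (Measurable.aestronglyMeasurable (by fun_prop)) n
    (Filter.Eventually.of_forall fun _ => (abs_clamp_le hn _).2)

/-- The easy half of Kantorovich duality. `u` need not be integrable for the common part `m₀`, so it
is truncated at level `n`; the contributions of `m₀` then cancel, and dominated convergence removes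
the truncation. -/
theorem ofReal_integral_sub_le_wassersteinOne {E Ω : Type*} [MeasurableSpace E]
    [PseudoMetricSpace E] [OpensMeasurableSpace E] [MeasurableSpace Ω]
    (m₀ : Measure E) [IsFiniteMeasure m₀] (ρ : Measure Ω) [IsFiniteMeasure ρ] {Y₁ Y₂ : Ω → E}
    (hY₁ : Measurable Y₁) (hY₂ : Measurable Y₂) {u : E → ℝ} (hu : LipschitzWith 1 u)
    (h₁ : Integrable (fun ω => u (Y₁ ω)) ρ) (h₂ : Integrable (fun ω => u (Y₂ ω)) ρ) :
    ENNReal.ofReal (∫ ω, (u (Y₁ ω) - u (Y₂ ω)) ∂ρ) ≤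
      wassersteinOne (m₀ + ρ.map Y₁) (m₀ + ρ.map Y₂) := by
  refine le_iInf₂ fun γ hγ => ?_
  have hum : Measurable u := hu.continuous.measurable
  have : IsFiniteMeasure γ := by
    refine ⟨?_⟩
    have h1 := measure_lt_top (m₀ + ρ.map Y₁) Set.univ
    rwa [← hγ.1, Measure.map_apply measurable_fst MeasurableSet.univ, Set.preimage_univ] at h1
  set c : ℕ → ℝ → ℝ := fun n s => max (-(n : ℝ)) (min n s) with hc
  have hcm : ∀ n, Measurable (c n) := fun n => by simp only [hc]; fun_prop
  have hcum : ∀ n, Measurable fun x => c n (u x) := fun n => (hcm n).comp hum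
  have hbound : ∀ n, ENNReal.ofReal (∫ ω, (c n (u (Y₁ ω)) - c n (u (Y₂ ω))) ∂ρ) ≤
      ∫⁻ p, edist p.1 p.2 ∂γ := by
    intro n
    have hmar : ∀ (Y : Ω → E), Measurable Y → ∫ x, c n (u x) ∂(m₀ + ρ.map Y) =
        ∫ x, c n (u x) ∂m₀ + ∫ ω, c n (u (Y ω)) ∂ρ := by
      intro Y hY
      rw [integral_add_measure (integrable_clamp n.cast_nonneg _ hum)
        (integrable_clamp n.cast_nonneg _ hum), integral_map hY.aemeasurable
        (hcum n).aestronglyMeasurable]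
    have h3 : ∫ x, c n (u x) ∂(m₀ + ρ.map Y₁) = ∫ p, c n (u p.1) ∂γ := by
      rw [← hγ.1, integral_map measurable_fst.aemeasurable (hcum n).aestronglyMeasurable]
    have h4 : ∫ x, c n (u x) ∂(m₀ + ρ.map Y₂) = ∫ p, c n (u p.2) ∂γ := by
      rw [← hγ.2, integral_map measurable_snd.aemeasurable (hcum n).aestronglyMeasurable]
    have h5 : ∫ ω, (c n (u (Y₁ ω)) - c n (u (Y₂ ω))) ∂ρ =
        ∫ p, (c n (u p.1) - c n (u p.2)) ∂γ := by
      have i1 : Integrable (fun ω => c n (u (Y₁ ω))) ρ :=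
        integrable_clamp n.cast_nonneg _ (hum.comp hY₁)
      have i2 : Integrable (fun ω => c n (u (Y₂ ω))) ρ :=
        integrable_clamp n.cast_nonneg _ (hum.comp hY₂)
      have i3 : Integrable (fun p : E × E => c n (u p.1)) γ :=
        integrable_clamp n.cast_nonneg _ (hum.comp measurable_fst)
      have i4 : Integrable (fun p : E × E => c n (u p.2)) γ :=
        integrable_clamp n.cast_nonneg _ (hum.comp measurable_snd)
      rw [integral_sub i1 i2, integral_sub i3 i4]
      rw [← h3, ← h4, hmar _ hY₁, hmar _ hY₂]
      ring
    rw [h5]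
    refine (ENNReal.ofReal_le_ofReal (le_abs_self _)).trans ?_
    rw [← Real.enorm_eq_ofReal_abs]
    refine (enorm_integral_le_lintegral_enorm _).trans (lintegral_mono fun p => ?_)
    rw [Real.enorm_eq_ofReal_abs, edist_dist]
    refine ENNReal.ofReal_le_ofReal ((abs_clamp_sub_clamp_le _ _ _).trans ?_)
    simpa [Real.dist_eq] using hu.dist_le_mul p.1 p.2
  have hlim : Filter.Tendsto (fun n : ℕ => ∫ ω, (c n (u (Y₁ ω)) - c n (u (Y₂ ω))) ∂ρ) Filter.atTop
      (nhds (∫ ω, (u (Y₁ ω) - u (Y₂ ω)) ∂ρ)) := by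
    refine tendsto_integral_of_dominated_convergence
      (fun ω => |u (Y₁ ω)| + |u (Y₂ ω)|) (fun n => ?_) (h₁.abs.add h₂.abs) (fun n => ?_) ?_
    · exact (((hcm n).comp (hum.comp hY₁)).sub ((hcm n).comp (hum.comp hY₂))).aestronglyMeasurable
    · refine Filter.Eventually.of_forall fun ω => (abs_sub _ _).trans (add_le_add ?_ ?_)
      · exact (abs_clamp_le n.cast_nonneg _).1
      · exact (abs_clamp_le n.cast_nonneg _).1
    · refine Filter.Eventually.of_forall fun ω => tendsto_const_nhds.congr' ?_
      obtain ⟨n₀, hn₀⟩ := exists_nat_ge (max |u (Y₁ ω)| |u (Y₂ ω)|)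
      filter_upwards [Filter.eventually_ge_atTop n₀] with n hn
      have hnn : max |u (Y₁ ω)| |u (Y₂ ω)| ≤ n := hn₀.trans (by exact_mod_cast hn)
      have hid : ∀ s : ℝ, |s| ≤ n → c n s = s := fun s hs => by
        rw [abs_le] at hs
        simp only [hc]
        rw [min_eq_right hs.2, max_eq_right hs.1]
      rw [hid _ ((le_max_left _ _).trans hnn), hid _ ((le_max_right _ _).trans hnn)]
  exact le_of_tendsto (ENNReal.tendsto_ofReal hlim) (Filter.Eventually.of_forall hbound)

end Wasserstein

/-! ### The uHMC kernel: one-step smoothing and a limit to contraction. -/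

section UHMC

variable {d : ℕ} {U : EuclideanSpace ℝ (Fin d) → ℝ} {h : ℝ} {N : ℕ} {L L_H : ℝ}

theorem bind_uhmcKernel_eq_map_prod (hU : ContDiff ℝ 1 U)
    (ν : Measure (EuclideanSpace ℝ (Fin d))) [SFinite ν] :
    ν.bind (uhmcKernel U h N) =
      (ν.prod (stdGaussian (EuclideanSpace ℝ (Fin d)))).map (verletPosition U h N) := by
  have hm := measurable_verletPosition hU h N
  ext A hA
  rw [Measure.bind_apply hA (Kernel.aemeasurable _), Measure.map_apply hm hA,
    Measure.prod_apply (hm hA)]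
  refine lintegral_congr fun x => ?_
  rw [uhmcKernel_apply hU, Measure.map_apply (by fun_prop) hA]
  rfl

theorem isMarkovKernel_uhmcKernel (hU : ContDiff ℝ 1 U) : IsMarkovKernel (uhmcKernel U h N) :=
  Kernel.IsMarkovKernel.map _ (measurable_verletPosition hU h N)

theorem abs_uhmcKernel_sub_le (hU : ContDiff ℝ 1 U) (hG : Differentiable ℝ (gradient U))
    (hL : ∀ x, ‖fderiv ℝ (gradient U) x‖ ≤ L) (hL_H : 0 ≤ L_H)
    (hH : ∀ x y, ‖fderiv ℝ (gradient U) x - fderiv ℝ (gradient U) y‖ ≤ L_H * ‖x - y‖)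
    (hh : 0 ≤ h) (hT : 0 < N * h) (hLT : L * (N * h) ^ 2 ≤ 1 / 6)
    (x y : EuclideanSpace ℝ (Fin d)) {A : Set (EuclideanSpace ℝ (Fin d))} (hA : MeasurableSet A) :
    |(uhmcKernel U h N x).real A - (uhmcKernel U h N y).real A| ≤
      √(18 / 25 * ((N * h) ^ 2)⁻¹ + 64 / 25 * d * L_H ^ 2 * (N * h) ^ 4) * dist x y := by
  rcases eq_or_ne x y with rfl | hxy
  · simp
  have hz : 0 < ‖x - y‖ := norm_pos_iff.2 (sub_ne_zero.2 hxy)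
  have hm := measurable_verletPosition hU h N
  obtain ⟨Φ, hbij, hΦ, hfun, hclose, h5, hδ⟩ := exists_velocity_transport hG hL hL_H hH hh hT hLT x y
  have hmy : Measurable fun v => verletPosition U h N (y, v) := by fun_prop
  have hmx : Measurable fun v => verletPosition U h N (x, v) := by fun_prop
  have key := abs_stdGaussian_sub_preimage_le hbij hΦ (a := 6 / 5 * ‖x - y‖ / (N * h))
    -- The minimum keeps `δ ≤ 1/5` for distant points, as the determinant bound requires, while the
    -- linear bound enters the result: `18/25 = (6/5)² / 2` and `64/25 = (8/5)²`.
    (by positivity) hclose (δ := min (1 / 5) (8 / 5 * L_H * (N * h) ^ 2 * ‖x - y‖))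
    (fun v => le_min (h5 v) (hδ v)) (min_le_left _ _) (hmy hA)
  rw [uhmcKernel_apply hU, uhmcKernel_apply hU, map_measureReal_apply hmx hA,
    map_measureReal_apply hmy hA, abs_sub_comm]
  have hpre : (fun v => verletPosition U h N (x, v)) ⁻¹' A =
      Φ ⁻¹' ((fun v => verletPosition U h N (y, v)) ⁻¹' A) := by
    ext v; simp [hfun]
  rw [hpre]
  refine key.trans ?_
  rw [dist_eq_norm, ← Real.sqrt_sq hz.le, ← Real.sqrt_mul (by positivity), Real.sqrt_sq hz.le]
  apply Real.sqrt_le_sqrt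
  have h0 : 0 ≤ min (1 / 5) (8 / 5 * L_H * (N * h) ^ 2 * ‖x - y‖) :=
    le_min (by norm_num) (by positivity)
  have h1 : min (1 / 5) (8 / 5 * L_H * (N * h) ^ 2 * ‖x - y‖) ^ 2 ≤
      (8 / 5 * L_H * (N * h) ^ 2 * ‖x - y‖) ^ 2 := by
    gcongr
    exact min_le_right _ _
  have h2 : (d : ℝ) * min (1 / 5) (8 / 5 * L_H * (N * h) ^ 2 * ‖x - y‖) ^ 2 ≤
      d * (8 / 5 * L_H * (N * h) ^ 2 * ‖x - y‖) ^ 2 := by gcongr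
  rw [finrank_euclideanSpace_fin]
  refine (add_le_add_right h2 _).trans (le_of_eq ?_)
  field_simp
  ring

/-- Translate the part of `μ` in a ball `B` by a unit vector `a`. This costs at most `μ B` in `W¹`,
yet with equal velocities the final positions still differ by at least `10/11` in direction `a`;
testing with `⟨a, ·⟩` shows that a distance `10/11 · μ B` survives. -/
theorem le_of_forall_wassersteinOne_bind_uhmcKernel_le (hU : ContDiff ℝ 1 U)
    (hG : Differentiable ℝ (gradient U)) (hL : ∀ x, ‖fderiv ℝ (gradient U) x‖ ≤ L)
    (hh : 0 ≤ h) (hLT : L * (N * h) ^ 2 ≤ 1 / 6) [NeZero d]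
    {μ : Measure (EuclideanSpace ℝ (Fin d))} [IsProbabilityMeasure μ]
    (hμ : (uhmcKernel U h N).Invariant μ) {r : ℝ} (hr : 0 ≤ r)
    (hW : ∀ ν : Measure (EuclideanSpace ℝ (Fin d)), IsProbabilityMeasure ν →
      wassersteinOne (ν.bind (uhmcKernel U h N)) μ ≤ ENNReal.ofReal r * wassersteinOne ν μ) :
    10 / 11 ≤ r := by
  have := isMarkovKernel_uhmcKernel (h := h) (N := N) hU
  have hm := measurable_verletPosition hU h N
  set a : EuclideanSpace ℝ (Fin d) := EuclideanSpace.single 0 1 with ha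
  have ha1 : ‖a‖ = 1 := by simp [ha]
  -- `μ` is not assumed to have a first moment; moving only its mass in a ball makes the test
  -- function integrable on the moved part.
  obtain ⟨n, hn⟩ : ∃ n : ℕ, μ (Metric.closedBall 0 n) ≠ 0 := by
    by_contra! hcon
    have h1 := measure_iUnion_null hcon
    rw [Metric.iUnion_closedBall_nat] at h1
    simp at h1
  set B : Set (EuclideanSpace ℝ (Fin d)) := Metric.closedBall 0 n with hB
  have hBm : MeasurableSet B := Metric.isClosed_closedBall.measurableSet
  have hsplit : μ = μ.restrict Bᶜ + μ.restrict B := by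
    rw [add_comm, Measure.restrict_add_restrict_compl hBm]
  have htr : Measurable fun x : EuclideanSpace ℝ (Fin d) => x + a := by fun_prop
  set ν := μ.restrict Bᶜ + (μ.restrict B).map fun x => x + a with hν
  have hνp : IsProbabilityMeasure ν := by
    refine ⟨?_⟩
    rw [hν, Measure.add_apply, Measure.map_apply htr MeasurableSet.univ, Set.preimage_univ,
      ← Measure.add_apply, ← hsplit, measure_univ]
  set g := stdGaussian (EuclideanSpace ℝ (Fin d)) with hg
  set ρ := (μ.restrict B).prod g with hρ
  have hupper : wassersteinOne ν μ ≤ μ B := by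
    have hd : Measurable fun x : EuclideanSpace ℝ (Fin d) => (x, x) := by fun_prop
    have hs : Measurable fun x : EuclideanSpace ℝ (Fin d) => (x + a, x) := by fun_prop
    have hcoup : IsCoupling ((μ.restrict Bᶜ).map (fun x => (x, x)) +
        (μ.restrict B).map (fun x => (x + a, x))) ν μ := by
      constructor
      · rw [Measure.map_add _ _ measurable_fst, Measure.map_map measurable_fst hd,
          Measure.map_map measurable_fst hs]
        simp only [Function.comp_def, Measure.map_id', hν]
      · rw [Measure.map_add _ _ measurable_snd, Measure.map_map measurable_snd hd,
          Measure.map_map measurable_snd hs]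
        simp only [Function.comp_def, Measure.map_id']
        exact hsplit.symm
    refine (wassersteinOne_le_lintegral hcoup).trans ?_
    rw [lintegral_add_measure, lintegral_map measurable_edist hd, lintegral_map measurable_edist hs]
    simp [edist_eq_enorm_sub, ← ofReal_norm, ha1]
  have hlower : ENNReal.ofReal (10 / 11 * μ.real B) ≤
      wassersteinOne (ν.bind (uhmcKernel U h N)) μ := by
    have hY₁ : Measurable fun p : EuclideanSpace ℝ (Fin d) × EuclideanSpace ℝ (Fin d) =>
      verletPosition U h N (p.1 + a, p.2) := by fun_prop
    have h1 : ν.bind (uhmcKernel U h N) = (μ.restrict Bᶜ).bind (uhmcKernel U h N) +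
        ρ.map fun p => verletPosition U h N (p.1 + a, p.2) := by
      have hpm := Measure.map_prod_map (μ.restrict B) g htr measurable_id
      rw [Measure.map_id] at hpm
      rw [bind_uhmcKernel_eq_map_prod hU, bind_uhmcKernel_eq_map_prod hU, hν,
        Measure.add_prod, Measure.map_add _ _ hm, hpm,
        Measure.map_map hm (htr.prodMap measurable_id)]
      rfl
    have h2 : μ = (μ.restrict Bᶜ).bind (uhmcKernel U h N) + ρ.map (verletPosition U h N) := by
      have hμ' : μ.bind (uhmcKernel U h N) = μ := hμ
      nth_rewrite 1 [← hμ']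
      rw [bind_uhmcKernel_eq_map_prod hU, bind_uhmcKernel_eq_map_prod hU, ← Measure.map_add _ _ hm,
        ← Measure.add_prod, ← hsplit]
    have hulip : LipschitzWith 1 fun x : EuclideanSpace ℝ (Fin d) => inner ℝ a x := by
      refine LipschitzWith.of_dist_le_mul fun x y => ?_
      rw [Real.dist_eq, dist_eq_norm, ← inner_sub_right]
      simpa [ha1] using abs_real_inner_le_norm a (x - y)
    have hρint : ∀ b : EuclideanSpace ℝ (Fin d),
        Integrable (fun p => inner ℝ a (verletPosition U h N (p.1 + b, p.2))) ρ := by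
      intro b
      have hi1 : Integrable (fun x : EuclideanSpace ℝ (Fin d) => ‖x‖) (μ.restrict B) := by
        refine Integrable.of_bound (by fun_prop) n ?_
        filter_upwards [ae_restrict_mem hBm] with x hx
        simpa [hB] using hx
      have hi2 := hi1.comp_fst g
      have hi3 : Integrable (fun p : EuclideanSpace ℝ (Fin d) × EuclideanSpace ℝ (Fin d) => ‖p.2‖)
        ρ := integrable_norm_stdGaussian.comp_snd (μ.restrict B)
      refine Integrable.mono' ((((hi2.add (integrable_const ‖b‖)).add
        (hi3.const_mul (N * h))).const_mul (12 / 11)).add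
        (integrable_const ‖verletPosition U h N (0, 0)‖)) ?_ ?_
      · exact Measurable.aestronglyMeasurable (by fun_prop)
      · refine Filter.Eventually.of_forall fun p => ?_
        have h3 := norm_verletPosition_sub_le hG hL hh hLT (p.1 + b) 0 p.2 0 le_rfl
        have h4 := norm_le_norm_sub_add (verletPosition U h N (p.1 + b, p.2))
          (verletPosition U h N (0, 0))
        have h5 := norm_inner_le_norm (𝕜 := ℝ) a (verletPosition U h N (p.1 + b, p.2))
        have h6 := norm_add_le p.1 b
        rw [ha1, one_mul] at h5
        simp only [sub_zero] at h3
        simp only [Pi.add_apply]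
        linarith
    have hi₁ := hρint a
    have hi₂ := hρint 0
    simp only [add_zero] at hi₂
    have h3 := ofReal_integral_sub_le_wassersteinOne ((μ.restrict Bᶜ).bind (uhmcKernel U h N)) ρ
      hY₁ hm hulip hi₁ hi₂
    rw [← h1, ← h2] at h3
    refine le_trans (ENNReal.ofReal_le_ofReal ?_) h3
    have h4 : ∫ _ : EuclideanSpace ℝ (Fin d) × EuclideanSpace ℝ (Fin d), (10 / 11 : ℝ) ∂ρ =
        10 / 11 * μ.real B := by
      rw [integral_const, smul_eq_mul, mul_comm]
      congr 1
      rw [hρ, measureReal_def, ← Set.univ_prod_univ, Measure.prod_prod]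
      simp [measureReal_def]
    rw [← h4]
    refine integral_mono (integrable_const _) (hi₁.sub hi₂) fun p => ?_
    have h5 := norm_verletPosition_sub_sub_le hG hL hh hLT (p.1 + a) p.1 p.2 p.2 le_rfl
    simp only [add_sub_cancel_left, sub_self, norm_zero, smul_zero, sub_zero, mul_zero, add_zero,
      ha1, mul_one] at h5
    have h6 : |inner ℝ a (verletPosition U h N (p.1 + a, p.2) -
        verletPosition U h N (p.1, p.2) - a)| ≤ 1 / 11 := by
      refine (abs_real_inner_le_norm _ _).trans ?_
      rw [ha1, one_mul]
      exact h5
    replace h6 := (abs_le.1 h6).1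
    rw [inner_sub_right, inner_sub_right, real_inner_self_eq_norm_sq, ha1] at h6
    simp only
    linarith
  have hB0 : 0 < μ.real B := ENNReal.toReal_pos hn (measure_ne_top _ _)
  have h1 : ENNReal.ofReal (10 / 11 * μ.real B) ≤ ENNReal.ofReal (r * μ.real B) := by
    refine hlower.trans ((hW ν hνp).trans ?_)
    rw [ENNReal.ofReal_mul hr, ofReal_measureReal]
    gcongr
  rw [ENNReal.ofReal_le_ofReal_iff (by positivity)] at h1
  exact le_of_mul_le_mul_right h1 hB0

theorem contDiff_gradient_and_norm_fderiv_eq (hU : ContDiff ℝ 3 U) :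
    ContDiff ℝ 2 (gradient U) ∧
    (∀ x, ‖fderiv ℝ (gradient U) x‖ = ‖iteratedFDeriv ℝ 2 U x‖) ∧
    ∀ x, ‖fderiv ℝ (fderiv ℝ (gradient U)) x‖ = ‖iteratedFDeriv ℝ 3 U x‖ := by
  have hgrad : gradient U = (InnerProductSpace.toDual ℝ (EuclideanSpace ℝ (Fin d))).symm ∘
    fderiv ℝ U := rfl
  have hiter : ∀ n x, ‖iteratedFDeriv ℝ n (gradient U) x‖ = ‖iteratedFDeriv ℝ (n + 1) U x‖ := by
    intro n x
    rw [hgrad, ← norm_iteratedFDeriv_fderiv]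
    exact LinearIsometryEquiv.norm_iteratedFDeriv_comp_left _ _ _ _
  refine ⟨?_, fun x => ?_, fun x => ?_⟩
  · rw [hgrad]
    exact (LinearIsometryEquiv.contDiff _).comp (hU.fderiv_right (by norm_num))
  · rw [← norm_iteratedFDeriv_one, hiter]
  · rw [← norm_iteratedFDeriv_one, norm_iteratedFDeriv_fderiv, hiter]

end UHMC

/-! ### Powers of the kernel and the conclusion. -/

theorem isMarkovKernel_pow {E : Type*} [MeasurableSpace E] (κ : Kernel E E) [IsMarkovKernel κ]
    (m : ℕ) : IsMarkovKernel (κ ^ m) := by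
  induction m with
  | zero =>
    rw [pow_zero]
    exact inferInstanceAs (IsMarkovKernel Kernel.id)
  | succ m ih =>
    rw [pow_succ']
    exact inferInstanceAs (IsMarkovKernel (κ ∘ₖ (κ ^ m)))

theorem bind_kernel_pow_succ {E : Type*} [MeasurableSpace E] (κ : Kernel E E) (ν : Measure E)
    (m : ℕ) : ν.bind ⇑(κ ^ (m + 1)) = (ν.bind ⇑(κ ^ m)).bind κ := by
  rw [pow_succ']
  exact Measure.comp_assoc.symm

theorem theorem1 (d : ℕ) (U : EuclideanSpace ℝ (Fin d) → ℝ) (L L_H : ℝ)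
    -- `U` is three times continuously differentiable, `L = sup ‖D²U‖` and `L_H = sup ‖D³U‖`
    (hU : ContDiff ℝ 3 U)
    (hL : IsLUB (Set.range fun x => ‖iteratedFDeriv ℝ 2 U x‖) L)
    (hL_H : IsLUB (Set.range fun x => ‖iteratedFDeriv ℝ 3 U x‖) L_H)
    -- the duration `T` and the step size `h`
    (T h : ℝ) (N : ℕ) (hT : 0 < T) (hh : 0 < h) (hTh : T / h = N)
    (hLT : L * (T ^ 2 + T * h) ≤ 1 / 6)
    -- the invariant probability measure and the contractivity in the Wasserstein distance
    (μ : Measure (EuclideanSpace ℝ (Fin d))) [IsProbabilityMeasure μ]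
    (hμ : (uhmcKernel U h N).Invariant μ)
    (M₁ c : ℝ) (hM₁ : 0 < M₁) (hc : 0 < c)
    (hA5 : ∀ m : ℕ, 1 ≤ m → ∀ ν : Measure (EuclideanSpace ℝ (Fin d)), IsProbabilityMeasure ν →
      wassersteinOne (ν.bind ⇑(uhmcKernel U h N ^ m)) μ ≤
        ENNReal.ofReal (M₁ * Real.exp (-c * m)) * wassersteinOne ν μ)
    (m : ℕ) (ν : Measure (EuclideanSpace ℝ (Fin d))) [IsProbabilityMeasure ν] :
    tvDist μ (ν.bind ⇑(uhmcKernel U h N ^ (m + 1))) ≤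
      ENNReal.ofReal (3 / 2 * √(T ^ (-2 : ℤ) + 27 * d * L_H ^ 2 * T ^ 4) * M₁) *
        wassersteinOne μ ν * ENNReal.ofReal (Real.exp (-c * m)) := by
  have hTN : T = N * h := by rw [← hTh, div_mul_cancel₀ _ hh.ne']
  have hL' : ∀ x, ‖iteratedFDeriv ℝ 2 U x‖ ≤ L := fun x => hL.1 ⟨x, rfl⟩
  have hL_H' : ∀ x, ‖iteratedFDeriv ℝ 3 U x‖ ≤ L_H := fun x => hL_H.1 ⟨x, rfl⟩
  have hL0 : 0 ≤ L := (norm_nonneg _).trans (hL' 0)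
  have hL_H0 : 0 ≤ L_H := (norm_nonneg _).trans (hL_H' 0)
  obtain ⟨hGc, hG1, hG2⟩ := contDiff_gradient_and_norm_fderiv_eq hU
  have hG : Differentiable ℝ (gradient U) := hGc.differentiable (by norm_num)
  have hGL : ∀ x, ‖fderiv ℝ (gradient U) x‖ ≤ L := fun x => (hG1 x).trans_le (hL' x)
  have hGd : Differentiable ℝ (fderiv ℝ (gradient U)) :=
    (hGc.fderiv_right (m := 1) (by norm_num)).differentiable (by norm_num)
  have hH : ∀ x y, ‖fderiv ℝ (gradient U) x - fderiv ℝ (gradient U) y‖ ≤ L_H * ‖x - y‖ :=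
    fun x y => convex_univ.norm_image_sub_le_of_norm_fderiv_le (fun z _ => hGd z)
      (fun z _ => (hG2 z).trans_le (hL_H' z)) (Set.mem_univ y) (Set.mem_univ x)
  have hU1 : ContDiff ℝ 1 U := hU.of_le (by norm_num)
  have hLT2 : L * (N * h) ^ 2 ≤ 1 / 6 := by
    rw [← hTN]
    have : 0 ≤ L * (T * h) := by positivity
    linarith
  have hκ : IsMarkovKernel (uhmcKernel U h N) := isMarkovKernel_uhmcKernel hU1
  set C := √(18 / 25 * (T ^ 2)⁻¹ + 64 / 25 * d * L_H ^ 2 * T ^ 4) with hC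
  set D := 3 / 2 * √(T ^ (-2 : ℤ) + 27 * d * L_H ^ 2 * T ^ 4) with hD
  have hC0 : 0 < C := Real.sqrt_pos.2 (by positivity)
  have hD0 : 0 ≤ D := by positivity
  -- `3/2 · 10/11 = 15/11`, whose square exceeds `18/25`, and `27 · (15/11)²` exceeds `64/25`. The
  -- spare factor `10/11` is what the case `m = 0` needs.
  have hCD : C ≤ D * (10 / 11) := by
    have h1 : D * (10 / 11) = √((15 / 11) ^ 2 * (T ^ (-2 : ℤ) + 27 * d * L_H ^ 2 * T ^ 4)) := by
      rw [Real.sqrt_mul (by positivity), Real.sqrt_sq (by norm_num)]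
      ring
    rw [h1, hC]
    apply Real.sqrt_le_sqrt
    have h2 : T ^ (-2 : ℤ) = (T ^ 2)⁻¹ := by rw [zpow_neg]; norm_cast
    rw [h2]
    have h3 : 0 ≤ (T ^ 2)⁻¹ := by positivity
    have h4 : 0 ≤ d * L_H ^ 2 * T ^ 4 := by positivity
    linarith
  have htv : ∀ ν' : Measure (EuclideanSpace ℝ (Fin d)), IsProbabilityMeasure ν' →
      tvDist μ (ν'.bind (uhmcKernel U h N)) ≤ ENNReal.ofReal C * wassersteinOne μ ν' := by
    intro ν' _
    have h1 := tvDist_bind_le (uhmcKernel U h N) hC0 (fun x y A hA => by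
      have := abs_uhmcKernel_sub_le hU1 hG hGL hL_H0 hH hh.le (hTN ▸ hT) hLT2 x y hA
      rwa [← hTN] at this) μ ν'
    rwa [show μ.bind (uhmcKernel U h N) = μ from hμ] at h1
  rcases Nat.eq_zero_or_pos m with rfl | hm
  · rw [zero_add, pow_one, Nat.cast_zero, mul_zero, Real.exp_zero, ENNReal.ofReal_one, mul_one]
    refine (htv ν inferInstance).trans ?_
    -- In dimension zero there is no unit vector to translate by, but all distances vanish.
    rcases Nat.eq_zero_or_pos d with rfl | hd
    · have h0 : wassersteinOne μ ν = 0 := by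
        have hcoup : IsCoupling (μ.prod ν) μ ν := ⟨by simp, by simp⟩
        refine le_antisymm ((wassersteinOne_le_lintegral hcoup).trans ?_) zero_le
        simp [Subsingleton.elim _ (0 : EuclideanSpace ℝ (Fin 0))]
      rw [h0, mul_zero]
      exact zero_le
    · have : NeZero d := ⟨hd.ne'⟩
      have hr : 10 / 11 ≤ M₁ * Real.exp (-c * (1 : ℕ)) :=
        le_of_forall_wassersteinOne_bind_uhmcKernel_le hU1 hG hGL hh.le hLT2 hμ (by positivity)
          fun ν' hν' => by simpa only [pow_one] using hA5 1 le_rfl ν' hν'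
      have hexp : Real.exp (-c * (1 : ℕ)) ≤ 1 := by
        rw [Real.exp_le_one_iff]
        simp [hc.le]
      have hM : 10 / 11 ≤ M₁ := hr.trans (mul_le_of_le_one_right hM₁.le hexp)
      gcongr
      exact hCD.trans (by gcongr)
  · rw [bind_kernel_pow_succ]
    have hpow := isMarkovKernel_pow (uhmcKernel U h N) m
    refine (htv _ inferInstance).trans ?_
    rw [wassersteinOne_comm]
    refine (mul_le_mul_right (hA5 m hm ν inferInstance) _).trans ?_
    rw [wassersteinOne_comm ν μ, ENNReal.ofReal_mul hM₁.le, ENNReal.ofReal_mul hD0]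
    have hle : ENNReal.ofReal C ≤ ENNReal.ofReal D :=
      ENNReal.ofReal_le_ofReal (hCD.trans (by linarith))
    calc ENNReal.ofReal C * (ENNReal.ofReal M₁ * ENNReal.ofReal (Real.exp (-c * m)) *
          wassersteinOne μ ν)
        ≤ ENNReal.ofReal D * (ENNReal.ofReal M₁ * ENNReal.ofReal (Real.exp (-c * m)) *
          wassersteinOne μ ν) := by gcongr
      _ = _ := by ring
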